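/- **Setting.** On $\mathbb H^1=\mathbb R^3$ (points $(z,t)$, $z=x+iy\in\mathbb C=\mathbb R^2$, Lebesgue measure) let $X=\partial_x+y\,\partial_t$ and $Y=\partial_y-x\,\partial_t$, and let $J(X)=Y$, $J(Y)=-X$, i.e. $J$ is multiplication by $i$ on horizontal vectors $fX+gY\simeq f+ig$. Let $K\subset\mathbb R^2$ be a convex body with $0\in\operatorname{int}K$ of class $C^2_+$ (its boundary is $C^2$ with positive curvature), and let $\|\cdot\|_K$ be the asymmetric norm (gauge) with unit ball $K$. For a measurable $E\subset\mathbb H^1$ and an open $\Omega$, $$P_K(E,\Omega)=\sup\Big\{\int_E (Xf+Yg)\;:\; f,g\in C^1_c(\Omega),\ \|(f,g)\|_K\le 1 \text{ everywhere}\Big\}.$$ $E$ has locally finite $K$-perimeter if it is measurable and $P_K(E,\Omega)<\infty$ for every bounded open $\Omega$. $E$ is $K$-perimeter-minimizing if it is measurable and $P_K(E,\Omega)\le P_K(F,\Omega)$ for every bounded open $\Omega$ and every measurable $F$ that coincides with $E$ outside a compact subset of $\Omega$. For a nonzero vector $w$ let $\pi_K(w)\in\partial K$ be the boundary point of $K$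 with outer unit normal $w/|w|$. Let $v\in\mathbb R^2\setminus\{0\}$. For $a\in(0,\pi)$ let $\beta(a)\in(\pi,2\pi)$ be the unique angle such that $\pi_K(J(ve^{ia}))-\pi_K(J(ve^{i\beta(a)}))$ is a multiple of $v$. Given $\alpha:\mathbb R\to(0,\pi)$, let $\Sigma_{v,\alpha}\subset\mathbb H^1$ be the union, over $\lambda\in\mathbb R$, of the two horizontal half-lines starting at $(\lambda v,0)$ and lying over the planar half-lines $\{\lambda v+\mu v e^{i\alpha(\lambda)}:\mu\ge0\}$ and $\{\lambda v+\mu ve^{i\beta(\alpha(\lambda))}:\mu\ge0\}$. **Proposition.** Suppose that $\alpha:\mathbb R\to(0,\pi)$ is continuous and non-increasing. Then $\Sigma_{v,\alpha}$ is the graph $\{t=u_\alpha(z)\}$ of a function $u_\alpha:\mathbb R^2\to\mathbb R$, and 1. $u_\alpha$ is locally Lipschitz in the Euclidean sense; 2. the subgraph $E_\alpha=\{t<u_\alpha(z)\}$, as well as the region $\{t>u_\alpha(z)\}$ above the graph, has locally finite $K$-perimeter; 3. $\Sigma_{v,\alpha}$, oriented so that its horizontal normal is a positive multiple of $J(Z)$,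 where $Z$ is the direction of the half-lines, is $K$-perimeter-minimizing in $\mathbb H^1$: the region $\{t>u_\alpha(z)\}$, which has this normal as its outer normal, is $K$-perimeter-minimizing. Equivalently, the subgraph $E_\alpha$ is $(-K)$-perimeter-minimizing; in particular $E_\alpha$ is $K$-perimeter-minimizing if $K=-K$. -/

import Mathlib

open scoped Pointwise

noncomputable section

namespace SubFinsler

/-- The first Heisenberg group in the coordinates `(z, t)`, `z = x + i y`. Its Riemannian volume
(for which `X`, `Y`, `T` are orthonormal) is Lebesgue measure. -/
abbrev Heis : Type := ℂ × ℝ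

/-- The left invariant field `X = ∂/∂x + y ∂/∂t`. -/
def fieldX (p : Heis) : Heis := (1, p.1.im)

/-- The left invariant field `Y = ∂/∂y - x ∂/∂t`. -/
def fieldY (p : Heis) : Heis := (Complex.I, -p.1.re)

/-- The divergence `X f + Y g` of the horizontal field `f X + g Y`, encoded as `w = f + i g`
(the fields `X` and `Y` are divergence free). -/
def hdiv (w : Heis → ℂ) (p : Heis) : ℝ :=
  (fderiv ℝ w p (fieldX p)).re + (fderiv ℝ w p (fieldY p)).im

/-- Horizontal fields of class `C¹` with compact support in `Ω` whose asymmetric `K`-norm (the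
gauge of `K`) is at most `1` everywhere. -/
def admissible (K : Set ℂ) (Ω : Set Heis) : Set (Heis → ℂ) :=
  {w | ContDiff ℝ 1 w ∧ HasCompactSupport w ∧ tsupport w ⊆ Ω ∧ ∀ p, gauge K (w p) ≤ 1}

/-- The horizontal `K`-perimeter of `E` in `Ω`. -/
def perimeter (K : Set ℂ) (E Ω : Set Heis) : EReal :=
  ⨆ w ∈ admissible K Ω, ((∫ p in E, hdiv w p : ℝ) : EReal)

/-- Lebesgue measurable sets of locally finite horizontal `K`-perimeter. -/
def HasLocallyFinitePerimeter (K : Set ℂ) (E : Set Heis) : Prop :=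
  MeasureTheory.NullMeasurableSet E ∧
    ∀ Ω : Set Heis, IsOpen Ω → Bornology.IsBounded Ω → perimeter K E Ω < ⊤

/-- `E` minimizes the `K`-perimeter among all its compact perturbations: in every bounded open
`Ω`, against every Lebesgue measurable `F` that agrees with `E` off a compact subset of `Ω`. -/
def IsPerimeterMinimizing (K : Set ℂ) (E : Set Heis) : Prop :=
  MeasureTheory.NullMeasurableSet E ∧
    ∀ Ω : Set Heis, IsOpen Ω → Bornology.IsBounded Ω →
      ∀ F : Set Heis, MeasureTheory.NullMeasurableSet F →
        (∃ C : Set Heis, IsCompact C ∧ C ⊆ Ω ∧ F \ C = E \ C) →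
          perimeter K E Ω ≤ perimeter K F Ω

/-- Planar convex bodies of class `C²₊`: the boundary is a simple closed curve of class `C²`,
run through counterclockwise by `γ` with positive curvature (`det (γ', γ'') > 0`, which contains
the regularity `γ' ≠ 0`). -/
structure IsC2Plus (K : Set ℂ) : Prop where
  convex : Convex ℝ K
  compact : IsCompact K
  boundary : ∃ (γ : ℝ → ℂ) (L : ℝ), 0 < L ∧ ContDiff ℝ 2 γ ∧ Function.Periodic γ L ∧
    Set.InjOn γ (Set.Ico 0 L) ∧ Set.range γ = frontier K ∧
    ∀ s, 0 < (deriv γ s).re * (deriv (deriv γ) s).im - (deriv γ s).im * (deriv (deriv γ) s).re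

/-- `n` is an outer unit normal to the convex set `K` at its boundary point `p`. -/
def IsOuterNormal (K : Set ℂ) (p n : ℂ) : Prop :=
  p ∈ frontier K ∧ ‖n‖ = 1 ∧ ∀ q ∈ K, inner ℝ (q - p) n ≤ 0

/-- The inverse Gauss map `N_K⁻¹`: the boundary point with outer unit normal `n`. For `K` of
class `C²₊` and `n` a unit vector there is exactly one such point. -/
def gaussInv (K : Set ℂ) (n : ℂ) : ℂ := Classical.epsilon fun p => IsOuterNormal K p n

/-- The map `π_K` on nonzero horizontal vectors: `π_K w = N_K⁻¹ (w / |w|)`. -/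
def piK (K : Set ℂ) (w : ℂ) : ℂ := gaussInv K (w / (‖w‖ : ℂ))

/-- `v e^{i a}`: the vector `v` turned by the angle `a`. -/
def turn (v : ℂ) (a : ℝ) : ℂ := v * Complex.exp (a * Complex.I)

/-- The angle `b ∈ (π, 2π)` is related to `a`: for `Z⁺ = v e^{i a}` and `Z⁻ = v e^{i b}`, the
vector `π_K (J Z⁺) - π_K (J Z⁻)` lies on the line spanned by `v`. Here `J` (`J X = Y`,
`J Y = - X`) is multiplication by `i`. -/
def IsConjAngle (K : Set ℂ) (v : ℂ) (a b : ℝ) : Prop :=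
  b ∈ Set.Ioo Real.pi (2 * Real.pi) ∧
    ∃ c : ℝ, piK K (Complex.I * turn v a) - piK K (Complex.I * turn v b) = (c : ℂ) * v

/-- The function `β : (0, π) → (π, 2π)`; for `K` of class `C²₊` and `v ≠ 0` the angle is unique. -/
def conjAngle (K : Set ℂ) (v : ℂ) (a : ℝ) : ℝ := Classical.epsilon fun b => IsConjAngle K v a b

/-- The horizontal half-line that starts at `(z₀, 0)` and lies over `{z₀ + μ d | μ ≥ 0}`. Its
tangent `d.re X + d.im Y` has `t`-component `z₀.im * d.re - z₀.re * d.im` at all of its points. -/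
def horizontalRay (z₀ d : ℂ) : Set Heis :=
  {p | ∃ μ : ℝ, 0 ≤ μ ∧ p = (z₀ + (μ : ℂ) * d, μ * (z₀.im * d.re - z₀.re * d.im))}

/-- The surface `Σ_{v,α}`: the union over `lam ∈ ℝ` of the horizontal half-lines that leave
`(lam v, 0)` in the directions `v e^{i α(lam)}` and `v e^{i β(α(lam))}`. -/
def surface (K : Set ℂ) (v : ℂ) (α : ℝ → ℝ) : Set Heis :=
  ⋃ lam : ℝ, horizontalRay ((lam : ℂ) * v) (turn v (α lam)) ∪
    horizontalRay ((lam : ℂ) * v) (turn v (conjAngle K v (α lam)))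

/-- The graph of a function over the `xy`-plane. -/
def tGraph (u : ℂ → ℝ) : Set Heis := {p | p.2 = u p.1}

/-- The open region below the graph. -/
def subgraph (u : ℂ → ℝ) : Set Heis := {p | p.2 < u p.1}

/-- The open region above the graph. -/
def supergraph (u : ℂ → ℝ) : Set Heis := {p | u p.1 < p.2}

end SubFinsler

end

open MeasureTheory Set Filter Topology
open scoped Pointwise NNReal Manifold

noncomputable section

namespace SubFinsler

/-! The proof is by calibration. In the coordinate `z / v` the half-lines from `lam` have slopes `cp
= cot α` above the real axis and `cm = -cot β` below it. The relation between `α` and `β` says that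
the boundary points of `K` attached to the two half-lines from `lam` have the same component `H lam`
along `J v`. This component is a strictly increasing continuous function of the slope
(`IsC2Plus.strictMono_height`), because `K` is strictly convex with a unique normal at each boundary
point. So `α` non-increasing makes `cp`, then `H`, then `cm` non-decreasing. Hence the half-lines
never cross, and by continuity they cover the plane (`IsRuling`). They form the graph of a function
that is Lipschitz on bounded sets.

The calibrating field `Φ` takes at `z` the boundary point of `K` with normal `J (z - Λ v)`, where
`Λ` is the foot of the half-line through `z`. It is independent of `t` but may jump, so its
divergence is not taken directly. Monotonicity of `H` shows instead that `Φ` is a rotated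
subgradient of a convex potential `ψ` (`isRotatedSubgradient_potential`). Rotated gradients of
mollifications of `ψ` are smooth, have values in `K` and have zero horizontal divergence. They need
not converge to `Φ`, but their component along `J (z - Λ v)` does
(`IsRotatedSubgradient.tendsto_fderiv_mollify`). This suffices, since the horizontal normal of the
graph is a nonnegative multiple of that vector (`IsRuling.hnormal_ruledHeight`).

After a cutoff these fields compete in the perimeter of any perturbation `F`. Their integrals over
`F` equal those over the supergraph, whose limit dominates the integral of every admissible field
(`isPerimeterMinimizing_supergraph`). Passing to complements exchanges `K` with `-K` and gives the
statement for the subgraph. -/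

/-! ### The Gauss-Green formula on Lipschitz graphs -/

/-- The horizontal part of the normal `∇(u - t)` to the graph of `u`. -/
def hnormal (u : ℂ → ℝ) (z : ℂ) : ℂ := ⟨fderiv ℝ u z 1 - z.im, fderiv ℝ u z Complex.I + z.re⟩

lemma complex_inner (a b : ℂ) : inner ℝ a b = a.re * b.re + a.im * b.im := by
  simp [Complex.inner, Complex.mul_re]; ring

lemma measurable_hnormal (u : ℂ → ℝ) : Measurable (hnormal u) := by
  have h1 : Measurable fun z : ℂ => fderiv ℝ u z 1 - z.im :=
    (measurable_fderiv_apply_const ℝ u 1).sub Complex.measurable_im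
  have h2 : Measurable fun z : ℂ => fderiv ℝ u z Complex.I + z.re :=
    (measurable_fderiv_apply_const ℝ u Complex.I).add Complex.measurable_re
  exact Complex.measurableEquivRealProd.symm.measurable.comp (h1.prodMk h2)

lemma norm_hnormal_le {u : ℂ → ℝ} {z : ℂ} {C : ℝ} (h : ‖fderiv ℝ u z‖ ≤ C) :
    ‖hnormal u z‖ ≤ 2 * (C + ‖z‖) := by
  have h1 := (fderiv ℝ u z).le_opNorm 1
  have h2 := (fderiv ℝ u z).le_opNorm Complex.I
  have h3 := Complex.norm_le_abs_re_add_abs_im (hnormal u z)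
  have h4 := Complex.abs_re_le_norm z
  have h5 := Complex.abs_im_le_norm z
  have h6 := abs_sub (fderiv ℝ u z 1) z.im
  have h7 := abs_add_le (fderiv ℝ u z Complex.I) z.re
  simp [hnormal] at *
  linarith

lemma continuous_hdiv {w : Heis → ℂ} (hw : ContDiff ℝ 1 w) : Continuous (hdiv w) := by
  have h := hw.continuous_fderiv (by norm_num)
  unfold hdiv fieldX fieldY
  refine Continuous.add (Complex.continuous_re.comp (h.clm_apply (by fun_prop)))
    (Complex.continuous_im.comp (h.clm_apply (by fun_prop)))

lemma tsupport_hdiv_subset (w : Heis → ℂ) : tsupport (hdiv w) ⊆ tsupport w := by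
  refine closure_minimal (fun p hp => ?_) (isClosed_tsupport w)
  refine support_fderiv_subset ℝ (f := w) ?_
  contrapose! hp
  simp only [Function.mem_support, ne_eq, not_not] at hp ⊢
  simp [hdiv, hp]

lemma hasCompactSupport_hdiv {w : Heis → ℂ} (hw : HasCompactSupport w) :
    HasCompactSupport (hdiv w) :=
  HasCompactSupport.of_support_subset_isCompact hw ((subset_tsupport _).trans (tsupport_hdiv_subset w))

lemma integrable_hdiv {w : Heis → ℂ} (hw : ContDiff ℝ 1 w) (hc : HasCompactSupport w) :
    Integrable (hdiv w) :=
  (continuous_hdiv hw).integrable_of_hasCompactSupport (hasCompactSupport_hdiv hc)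

/-- The shear that flattens the graph of `u`. -/
def shear (u : ℂ → ℝ) (hu : Continuous u) : Heis ≃ₜ Heis where
  toFun p := (p.1, u p.1 + p.2)
  invFun p := (p.1, p.2 - u p.1)
  left_inv p := by simp
  right_inv p := by simp
  continuous_toFun := by fun_prop
  continuous_invFun := by fun_prop

lemma measurePreserving_shear (u : ℂ → ℝ) (hu : Continuous u) :
    MeasurePreserving (shear u hu) (volume : Measure Heis) volume :=
  (MeasurePreserving.id (volume : Measure ℂ)).skew_product
    (g := fun z s => u z + s) (μc := (volume : Measure ℝ)) (μd := volume)
    (by unfold Function.uncurry; fun_prop)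
    (Eventually.of_forall fun z => (measurePreserving_add_left volume (u z)).map_eq)

/-- Integration by parts against the constant function 1. -/
lemma integral_lineDeriv_eq_zero {f : ℂ → ℝ} {C : ℝ≥0} (hf : LipschitzWith C f)
    (hc : HasCompactSupport f) (v : ℂ) : ∫ z, lineDeriv ℝ f z v = 0 := by
  have h := LipschitzWith.integral_lineDeriv_mul_eq (μ := (volume : Measure ℂ))
    (LipschitzWith.const (1 : ℝ)) hf hc (-v)
  have h0 : ∀ x : ℂ, lineDeriv ℝ (fun _ : ℂ => (1 : ℝ)) x (-v) = 0 := fun x => by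
    simp [lineDeriv]
  simpa [h0] using h.symm

lemma integrable_lineDeriv {f : ℂ → ℝ} {C : ℝ≥0} (hf : LipschitzWith C f)
    (hc : HasCompactSupport f) (v : ℂ) : Integrable fun z => lineDeriv ℝ f z v := by
  refine (integrableOn_iff_integrable_of_support_subset ?_).1
    ((hf.locallyIntegrable_lineDeriv (μ := volume) v).integrableOn_isCompact hc.isCompact)
  intro z hz
  contrapose! hz
  have h : f =ᶠ[𝓝 z] fun _ => 0 := notMem_tsupport_iff_eventuallyEq.1 hz
  rw [Function.notMem_support, Filter.EventuallyEq.lineDeriv_eq h]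
  simp [lineDeriv]

lemma lipschitzWith_slice {u : ℂ → ℝ} {C : ℝ≥0} (hu : LipschitzWith C u) {w : Heis → ℂ}
    (hw : ContDiff ℝ 1 w) (hc : HasCompactSupport w) (s : ℝ) :
    ∃ D, LipschitzWith D fun z => w (z, u z + s) := by
  obtain ⟨D, hD⟩ := hw.lipschitzWith_of_hasCompactSupport hc (by norm_num)
  exact ⟨_, hD.comp (LipschitzWith.id.prodMk (hu.add (LipschitzWith.const s)))⟩

lemma hasCompactSupport_slice {u : ℂ → ℝ} {w : Heis → ℂ} (hc : HasCompactSupport w) (s : ℝ) :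
    HasCompactSupport fun z => w (z, u z + s) := by
  refine HasCompactSupport.intro (hc.isCompact.image continuous_fst) fun z hz => ?_
  exact image_eq_zero_of_notMem_tsupport fun h => hz ⟨_, h, rfl⟩

/-- The divergence theorem on the translate by `s` of the graph of `u`. -/
lemma integral_hdiv_slice {u : ℂ → ℝ} {C : ℝ≥0} (hu : LipschitzWith C u) {w : Heis → ℂ}
    (hw : ContDiff ℝ 1 w) (hc : HasCompactSupport w) (s : ℝ) :
    ∫ z, (hdiv w (z, u z + s) +
      inner ℝ (fderiv ℝ w (z, u z + s) (0, 1)) (hnormal u z)) = 0 := by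
  obtain ⟨D, hD⟩ := lipschitzWith_slice hu hw hc s
  have hcs := hasCompactSupport_slice (u := u) hc s
  have hre : LipschitzWith D fun z => (w (z, u z + s)).re := by
    have := (Complex.reCLM.lipschitz.weaken (K' := 1) (by simp)).comp hD
    rwa [one_mul] at this
  have him : LipschitzWith D fun z => (w (z, u z + s)).im := by
    have := (Complex.imCLM.lipschitz.weaken (K' := 1) (by simp)).comp hD
    rwa [one_mul] at this
  have cre : HasCompactSupport fun z => (w (z, u z + s)).re := hcs.comp_left (g := Complex.re) rfl
  have cim : HasCompactSupport fun z => (w (z, u z + s)).im := hcs.comp_left (g := Complex.im) rfl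
  have i1 := integrable_lineDeriv hre cre 1
  have i2 := integrable_lineDeriv him cim Complex.I
  have key := congrArg₂ (· + ·) (integral_lineDeriv_eq_zero hre cre 1)
    (integral_lineDeriv_eq_zero him cim Complex.I)
  rw [← integral_add i1 i2, add_zero] at key
  rw [← key]
  apply integral_congr_ae
  -- Rademacher's theorem: the chain rule for `w (z, u z + s)` is available almost everywhere.
  filter_upwards [hu.ae_differentiableAt] with z hz
  have hwd := (hw.differentiable (by norm_num) (z, u z + s)).hasFDerivAt
  have hcomp : HasFDerivAt (fun z => w (z, u z + s)) _ z :=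
    hwd.comp z ((hasFDerivAt_id z).prodMk (hz.hasFDerivAt.add_const s))
  have h1 := (Complex.reCLM.hasFDerivAt.comp z hcomp).hasLineDerivAt 1 |>.lineDeriv
  have h2 := (Complex.imCLM.hasFDerivAt.comp z hcomp).hasLineDerivAt Complex.I |>.lineDeriv
  have e1 : lineDeriv ℝ (fun z => (w (z, u z + s)).re) z 1 = _ := h1
  have e2 : lineDeriv ℝ (fun z => (w (z, u z + s)).im) z Complex.I = _ := h2
  -- The tangent vectors `(1, ∂ₓu)` and `(I, ∂ᵧu)` differ from the fields `X` and `Y` by vertical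
  -- vectors, whose lengths are the two components of `hnormal u z`.
  have split : ∀ (a : ℂ) (b : ℝ), fderiv ℝ w (z, u z + s) (a, b) =
      fderiv ℝ w (z, u z + s) (a, 0) + b • fderiv ℝ w (z, u z + s) (0, 1) := fun a b => by
    rw [← map_smul, ← map_add]; simp
  rw [e1, e2]
  simp only [hdiv, fieldX, fieldY, hnormal, complex_inner, ContinuousLinearMap.comp_apply,
    ContinuousLinearMap.prod_apply, ContinuousLinearMap.id_apply, Complex.reCLM_apply,
    Complex.imCLM_apply]
  rw [split 1 z.im, split Complex.I (-z.re), split 1 (fderiv ℝ u z 1),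
    split Complex.I (fderiv ℝ u z Complex.I)]
  simp only [Complex.add_re, Complex.add_im, Complex.real_smul, Complex.re_ofReal_mul,
    Complex.im_ofReal_mul]
  ring

/-- The divergence theorem on a union of translates of a Lipschitz graph. -/
lemma setIntegral_hdiv_preimage {u : ℂ → ℝ} {C : ℝ≥0} (hu : LipschitzWith C u) {w : Heis → ℂ}
    (hw : ContDiff ℝ 1 w) (hc : HasCompactSupport w) (S : Set ℝ) :
    ∫ p in {p : Heis | p.2 - u p.1 ∈ S}, hdiv w p =
      -∫ z, ∫ s in S, inner ℝ (fderiv ℝ w (z, u z + s) (0, 1)) (hnormal u z) := by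
  have hcd := hw.continuous_fderiv (by norm_num)
  set e := shear u hu.continuous with he
  have heval : ∀ p, e p = (p.1, u p.1 + p.2) := fun p => rfl
  have hmp := measurePreserving_shear u hu.continuous
  have hpre : e ⁻¹' {p : Heis | p.2 - u p.1 ∈ S} = univ ×ˢ S := by
    ext p; simp [heval]
  have hi : Integrable fun p => hdiv w (e p) :=
    (hmp.integrable_comp_emb e.measurableEmbedding).2 (integrable_hdiv hw hc)
  have hi2 : Integrable fun p : Heis =>
      (inner ℝ (fderiv ℝ w (e p) (0, 1)) (hnormal u p.1) : ℝ) := by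
    -- `hnormal u` is only measurable, so integrability comes from a continuous compactly supported
    -- majorant.
    have hb : Integrable fun p : Heis => ‖fderiv ℝ w (e p) (0, 1)‖ * (2 * (C + ‖p.1‖)) := by
      refine Continuous.integrable_of_hasCompactSupport ?_ ?_
      · exact ((hcd.comp e.continuous).clm_apply continuous_const).norm.mul (by fun_prop)
      · have h1 : HasCompactSupport fun p => fderiv ℝ w (e p) :=
          (hc.fderiv ℝ).comp_homeomorph e
        refine h1.mono fun p hp => ?_
        contrapose! hp
        simp only [Function.mem_support, ne_eq, not_not] at hp ⊢
        simp [hp]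
    refine hb.mono ?_ (Eventually.of_forall fun p => ?_)
    · refine AEStronglyMeasurable.inner ?_ ?_
      · exact ((hcd.comp e.continuous).clm_apply continuous_const).aestronglyMeasurable
      · exact ((measurable_hnormal u).comp measurable_fst).aestronglyMeasurable
    · refine (norm_inner_le_norm _ _).trans ((mul_le_mul_of_nonneg_left
        (norm_hnormal_le (norm_fderiv_le_of_lipschitz ℝ hu)) (norm_nonneg _)).trans ?_)
      exact le_abs_self _
  rw [← hmp.setIntegral_preimage_emb e.measurableEmbedding]
  change ∫ p in e ⁻¹' _, hdiv w (e p) = _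
  rw [hpre]
  have hr : (volume : Measure Heis).restrict (univ ×ˢ S) =
      (volume : Measure ℂ).prod ((volume : Measure ℝ).restrict S) := by
    rw [Measure.volume_eq_prod, ← Measure.prod_restrict, Measure.restrict_univ]
  have hiS : Integrable (fun p => hdiv w (e p))
      ((volume : Measure ℂ).prod ((volume : Measure ℝ).restrict S)) := hr ▸ hi.integrableOn
  have hi2S : Integrable (fun p : Heis =>
      (inner ℝ (fderiv ℝ w (e p) (0, 1)) (hnormal u p.1) : ℝ))
      ((volume : Measure ℂ).prod ((volume : Measure ℝ).restrict S)) := hr ▸ hi2.integrableOn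
  rw [hr, eq_neg_iff_add_eq_zero]
  -- Integrating over `z` first makes every slice vanish; the second term is then integrated in the
  -- other order.
  have hz : ∫ p, (hdiv w (e p) + inner ℝ (fderiv ℝ w (e p) (0, 1)) (hnormal u p.1))
      ∂((volume : Measure ℂ).prod ((volume : Measure ℝ).restrict S)) = 0 := by
    refine (integral_prod_symm _ (hiS.add hi2S)).trans ?_
    simp only [Pi.add_apply, heval, integral_hdiv_slice hu hw hc, integral_zero]
  rw [integral_add hiS hi2S, integral_prod _ hi2S] at hz
  exact hz

lemma hasDerivAt_vertical {w : Heis → ℂ} (hw : ContDiff ℝ 1 w) (z : ℂ) (a s : ℝ) :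
    HasDerivAt (fun s => w (z, a + s)) (fderiv ℝ w (z, a + s) (0, 1)) s := by
  have h := (hw.differentiable (by norm_num) (z, a + s)).hasFDerivAt
  exact h.comp_hasDerivAt s ((hasDerivAt_const s z).prodMk ((hasDerivAt_id s).const_add a))

lemma hasCompactSupport_vertical {w : Heis → ℂ} (hc : HasCompactSupport w) (z : ℂ) (a : ℝ) :
    HasCompactSupport fun s : ℝ => w (z, a + s) := by
  refine HasCompactSupport.intro (hc.isCompact.image (f := fun p : Heis => p.2 - a)
    (by fun_prop)) fun s hs => ?_
  exact image_eq_zero_of_notMem_tsupport fun h => hs ⟨_, h, by simp⟩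

lemma integral_vertical {w : Heis → ℂ} (hw : ContDiff ℝ 1 w) (hc : HasCompactSupport w) (z n : ℂ)
    (a : ℝ) :
    ∫ s in Ioi (0 : ℝ), inner ℝ (fderiv ℝ w (z, a + s) (0, 1)) n = -inner ℝ (w (z, a)) n ∧
    ∫ s : ℝ, inner ℝ (fderiv ℝ w (z, a + s) (0, 1)) n = 0 := by
  have hcs := hasCompactSupport_vertical hc z a
  have hd : ∀ s, HasDerivAt (fun s => (inner ℝ (w (z, a + s)) n : ℝ))
      (inner ℝ (fderiv ℝ w (z, a + s) (0, 1)) n) s := fun s => by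
    simpa using (hasDerivAt_vertical hw z a s).inner ℝ (hasDerivAt_const s n)
  have hcf : HasCompactSupport fun s : ℝ => (inner ℝ (w (z, a + s)) n : ℝ) :=
    hcs.mono fun s hs => by
      contrapose! hs
      simp only [Function.mem_support, ne_eq, not_not] at hs ⊢
      simp [hs]
  have hder : deriv (fun s => (inner ℝ (w (z, a + s)) n : ℝ)) =
      fun s => inner ℝ (fderiv ℝ w (z, a + s) (0, 1)) n := funext fun s => (hd s).deriv
  have hcont : Continuous (deriv (fun s => (inner ℝ (w (z, a + s)) n : ℝ))) := by
    rw [hder]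
    exact (((hw.continuous_fderiv (by norm_num)).comp (by fun_prop)).clm_apply
      continuous_const).inner continuous_const
  have hC1 : ContDiff ℝ 1 fun s => (inner ℝ (w (z, a + s)) n : ℝ) :=
    contDiff_one_iff_deriv.2 ⟨fun s => (hd s).differentiableAt, hcont⟩
  constructor
  · have := hcf.integral_Ioi_deriv_eq hC1 0
    rw [hder] at this
    simpa only [add_zero] using this
  · have := integral_of_hasDerivAt_of_tendsto hd
      (hder ▸ hcont.integrable_of_hasCompactSupport hcf.deriv)
      (hcf.is_zero_at_infty.mono_left atBot_le_cocompact)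
      (hcf.is_zero_at_infty.mono_left atTop_le_cocompact)
    simpa using this

/-- The Gauss-Green formula above a Lipschitz graph. -/
lemma setIntegral_hdiv_supergraph_of_lipschitzWith {u : ℂ → ℝ} {C : ℝ≥0} (hu : LipschitzWith C u)
    {w : Heis → ℂ} (hw : ContDiff ℝ 1 w) (hc : HasCompactSupport w) :
    ∫ p in supergraph u, hdiv w p = ∫ z, inner ℝ (w (z, u z)) (hnormal u z) := by
  have h := setIntegral_hdiv_preimage hu hw hc (Ioi 0)
  have hs : {p : Heis | p.2 - u p.1 ∈ Ioi 0} = supergraph u := by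
    ext p; simp [supergraph]
  rw [hs] at h
  rw [h, ← integral_neg]
  congr 1 with z
  rw [(integral_vertical hw hc z _ _).1, neg_neg]

lemma integral_hdiv {w : Heis → ℂ} (hw : ContDiff ℝ 1 w) (hc : HasCompactSupport w) :
    ∫ p, hdiv w p = 0 := by
  have h := setIntegral_hdiv_preimage (LipschitzWith.const (0 : ℝ)) hw hc univ
  simp only [mem_univ, ofPred_true, Measure.restrict_univ] at h
  rw [h]
  have h2 : ∀ z, ∫ s : ℝ, (inner ℝ (fderiv ℝ w (z, 0 + s) (0, 1)) (hnormal (fun _ => 0) z) : ℝ) = 0 :=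
    fun z => (integral_vertical hw hc z _ _).2
  simp only [h2, integral_zero, neg_zero]

/-- The Gauss-Green formula above a graph that is Lipschitz on bounded sets. -/
lemma setIntegral_hdiv_supergraph {u : ℂ → ℝ}
    (hu : ∀ R : ℝ, ∃ C : ℝ≥0, LipschitzOnWith C u (Metric.closedBall 0 R))
    {w : Heis → ℂ} (hw : ContDiff ℝ 1 w) (hc : HasCompactSupport w) :
    ∫ p in supergraph u, hdiv w p = ∫ z, inner ℝ (w (z, u z)) (hnormal u z) := by
  obtain ⟨R, hR⟩ := (hc.isCompact.image continuous_fst).isBounded.subset_ball 0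
  have hR' : ∀ p : Heis, p.1 ∉ Metric.ball 0 R → p ∉ tsupport w := fun p hp h =>
    hp (hR ⟨p, h, rfl⟩)
  obtain ⟨C, hC⟩ := hu R
  -- The field vanishes off the cylinder over the ball, so `u` may be replaced by a globally
  -- Lipschitz extension of its restriction.
  obtain ⟨g, hg, hgu⟩ := hC.extend_real
  have key := setIntegral_hdiv_supergraph_of_lipschitzWith hg hw hc
  have hgu' : ∀ z ∈ Metric.ball (0 : ℂ) R, u z = g z := fun z hz =>
    hgu (Metric.ball_subset_closedBall hz)
  have e1 : ∫ p in supergraph u, hdiv w p = ∫ p in supergraph g, hdiv w p := by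
    have hm : MeasurableSet (Prod.fst ⁻¹' Metric.ball (0 : ℂ) R : Set Heis) :=
      measurable_fst measurableSet_ball
    have hz : ∀ A : Set Heis, ∫ p in A, hdiv w p =
        ∫ p in A ∩ Prod.fst ⁻¹' Metric.ball (0 : ℂ) R, hdiv w p := fun A => by
      rw [← integral_inter_add_sdiff hm (integrable_hdiv hw hc).integrableOn,
        setIntegral_eq_zero_of_forall_eq_zero (t := A \ _), add_zero]
      intro p hp
      refine image_eq_zero_of_notMem_tsupport fun h => hR' p hp.2 ?_
      exact tsupport_hdiv_subset w h
    rw [hz, hz (supergraph g)]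
    congr 2
    ext p
    simp only [supergraph, mem_inter_iff, mem_ofPred_eq, mem_preimage]
    exact and_congr_left fun hp => by rw [hgu' _ hp]
  rw [e1, key]
  congr 1 with z
  by_cases hz : z ∈ Metric.ball (0 : ℂ) R
  · have : u =ᶠ[𝓝 z] g := by
      filter_upwards [Metric.isOpen_ball.mem_nhds hz] with y hy using hgu' y hy
    simp only [hnormal, this.fderiv_eq, hgu' z hz]
  · rw [image_eq_zero_of_notMem_tsupport (hR' (z, g z) hz),
      image_eq_zero_of_notMem_tsupport (hR' (z, u z) hz)]
    simp

/-! ### Support points and normals of convex bodies of class `C²₊` -/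

/-- `p` is a point of `K` at which the linear functional `⟨·, n⟩` attains its maximum on `K`. -/
def IsSupportPoint (K : Set ℂ) (n p : ℂ) : Prop :=
  p ∈ K ∧ ∀ q ∈ K, (inner ℝ q n : ℝ) ≤ inner ℝ p n

lemma exists_pos_smul_mem {K : Set ℂ} {p : ℂ} (hp : p ∈ interior K) (n : ℂ) :
    ∃ ε : ℝ, 0 < ε ∧ p + ε • n ∈ K := by
  have h : Tendsto (fun ε : ℝ => p + ε • n) (𝓝[>] 0) (𝓝 p) := by
    have : Continuous fun ε : ℝ => p + ε • n := by fun_prop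
    simpa using (this.tendsto 0).mono_left nhdsWithin_le_nhds
  have := h.eventually (mem_interior_iff_mem_nhds.1 hp)
  obtain ⟨ε, h1, h2⟩ := (this.and self_mem_nhdsWithin).exists
  exact ⟨ε, h2, h1⟩

lemma IsSupportPoint.notMem_interior {K : Set ℂ} {n p : ℂ} (h : IsSupportPoint K n p)
    (hn : n ≠ 0) : p ∉ interior K := by
  intro hp
  obtain ⟨ε, hε, hm⟩ := exists_pos_smul_mem hp n
  have := h.2 _ hm
  rw [inner_add_left, real_inner_smul_left, real_inner_self_eq_norm_sq] at this
  have : 0 < ε * ‖n‖ ^ 2 := by positivity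
  linarith

lemma IsSupportPoint.mem_frontier {K : Set ℂ} {n p : ℂ} (h : IsSupportPoint K n p)
    (hn : n ≠ 0) : p ∈ frontier K :=
  ⟨subset_closure h.1, h.notMem_interior hn⟩

lemma inner_div_norm (q n : ℂ) : (inner ℝ q (n / (‖n‖ : ℂ)) : ℝ) = ‖n‖⁻¹ * inner ℝ q n := by
  have : n / (‖n‖ : ℂ) = ‖n‖⁻¹ • n := by
    rw [Complex.real_smul, Complex.ofReal_inv]; field_simp
  rw [this, real_inner_smul_right]

lemma isOuterNormal_iff {K : Set ℂ} (hK : IsClosed K) {n p : ℂ} (hn : n ≠ 0) :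
    IsOuterNormal K p (n / (‖n‖ : ℂ)) ↔ IsSupportPoint K n p := by
  have hpos : 0 < ‖n‖⁻¹ := by positivity
  constructor
  · rintro ⟨h1, -, h3⟩
    refine ⟨hK.frontier_subset h1, fun q hq => ?_⟩
    have := h3 q hq
    rw [inner_div_norm, inner_sub_left] at this
    have := nonpos_of_mul_nonpos_right this hpos
    linarith
  · intro h
    refine ⟨h.mem_frontier hn, by simp [hn], fun q hq => ?_⟩
    rw [inner_div_norm, inner_sub_left]
    exact mul_nonpos_of_nonneg_of_nonpos hpos.le (by linarith [h.2 q hq])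

lemma isSupportPoint_piK {K : Set ℂ} (hK : IsCompact K) (h0 : K.Nonempty) {n : ℂ} (hn : n ≠ 0) :
    IsSupportPoint K n (piK K n) := by
  obtain ⟨p, hp, hmax⟩ := hK.exists_isMaxOn h0
    (f := fun q => (inner ℝ q n : ℝ)) (by fun_prop)
  have hs : IsSupportPoint K n p := ⟨hp, fun q hq => hmax hq⟩
  have := Classical.epsilon_spec (p := fun p => IsOuterNormal K p (n / (‖n‖ : ℂ)))
    ⟨p, (isOuterNormal_iff hK.isClosed hn).2 hs⟩
  exact (isOuterNormal_iff hK.isClosed hn).1 this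

lemma piK_real_mul (K : Set ℂ) {r : ℝ} (hr : 0 < r) (n : ℂ) : piK K ((r : ℂ) * n) = piK K n := by
  have : (r : ℂ) ≠ 0 := by exact_mod_cast hr.ne'
  rw [piK, piK, norm_mul, Complex.norm_real, Real.norm_of_nonneg hr.le, Complex.ofReal_mul,
    mul_div_mul_left _ _ this]

section C2Plus

variable {K : Set ℂ}

lemma inner_deriv_eq_zero (hK : IsClosed K) {γ : ℝ → ℂ} (hγ : Differentiable ℝ γ)
    (hr : range γ = frontier K) {n : ℂ} {s : ℝ} (h : IsSupportPoint K n (γ s)) :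
    (inner ℝ (deriv γ s) n : ℝ) = 0 := by
  have hd : HasDerivAt (fun s => (inner ℝ (γ s) n : ℝ)) (inner ℝ (deriv γ s) n) s := by
    simpa using (hγ s).hasDerivAt.inner ℝ (hasDerivAt_const s n)
  have hm : IsLocalMax (fun s => (inner ℝ (γ s) n : ℝ)) s :=
    Eventually.of_forall fun t => h.2 _ (hK.frontier_subset (hr ▸ mem_range_self t))
  exact hd.deriv ▸ hm.deriv_eq_zero

/-- Convex bodies of class `C²₊` are strictly convex. -/
lemma IsC2Plus.supportPoint_unique (hK : IsC2Plus K) {n p q : ℂ} (hn : n ≠ 0)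
    (hp : IsSupportPoint K n p) (hq : IsSupportPoint K n q) : p = q := by
  by_contra hpq
  obtain ⟨γ, L, hL, hγ, hper, -, hr, hcurv⟩ := hK.boundary
  have hcl := hK.compact.isClosed
  have hd1 : Differentiable ℝ γ := hγ.differentiable (by norm_num)
  have hγ' : ContDiff ℝ 1 (deriv γ) := hγ.iterate_deriv' 1 1
  have hd2 : Differentiable ℝ (deriv γ) := hγ'.differentiable (by norm_num)
  -- If `p ≠ q`, the whole segment between them consists of support points, so `S` is infinite and
  -- accumulates at some `s0`. There `⟨γ', n⟩` vanishes without being an isolated zero, so `⟨γ'',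
  -- n⟩` vanishes too. Then `γ'` and `γ''` are both orthogonal to `n`, against positive curvature.
  set S := {s ∈ Icc 0 L | IsSupportPoint K n (γ s)} with hS
  have hinf : S.Infinite := by
    have hseg : ∀ t ∈ Icc (0 : ℝ) 1, IsSupportPoint K n (AffineMap.lineMap p q t) := by
      intro t ht
      refine ⟨hK.convex.lineMap_mem hp.1 hq.1 ht, fun x hx => ?_⟩
      rw [AffineMap.lineMap_apply_module, inner_add_left, real_inner_smul_left,
        real_inner_smul_left]
      have h1 := hp.2 x hx
      have h2 := hq.2 p hp.1
      have h3 := hp.2 q hq.1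
      have : (inner ℝ p n : ℝ) = inner ℝ q n := le_antisymm h2 h3
      rw [← this]; linarith
    have hinj : Function.Injective (AffineMap.lineMap p q : ℝ → ℂ) :=
      AffineMap.lineMap_injective ℝ hpq
    have himg : ((AffineMap.lineMap p q : ℝ → ℂ) '' Icc 0 1).Infinite :=
      (Icc_infinite zero_lt_one).image hinj.injOn
    refine Infinite.of_image γ (himg.mono ?_)
    rintro _ ⟨t, ht, rfl⟩
    have hm := hseg t ht
    have : AffineMap.lineMap p q t ∈ range γ := hr ▸ hm.mem_frontier hn
    obtain ⟨s, hs⟩ := this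
    obtain ⟨s', hs', hss⟩ := hper.exists_mem_Ico₀ hL s
    exact ⟨s', ⟨Ico_subset_Icc_self hs', by rwa [← hss, hs]⟩, by rw [← hss, hs]⟩
  obtain ⟨s0, -, hs0⟩ := hinf.exists_accPt_of_subset_isCompact isCompact_Icc (fun s hs => hs.1)
  have hzero : ∀ s ∈ S, (inner ℝ (deriv γ s) n : ℝ) = 0 := fun s hs =>
    inner_deriv_eq_zero hcl hd1 hr hs.2
  have hfreq := accPt_iff_frequently_nhdsNE.1 hs0
  have hcont : Continuous fun s => (inner ℝ (deriv γ s) n : ℝ) :=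
    hγ'.continuous.inner continuous_const
  have h0 : (inner ℝ (deriv γ s0) n : ℝ) = 0 := by
    by_contra hne
    have := (hcont.continuousAt.eventually_ne hne).filter_mono
      (nhdsWithin_le_nhds (s := {s0}ᶜ))
    obtain ⟨s, h1, h2⟩ := (hfreq.and_eventually this).exists
    exact h2 (hzero s h1)
  have hdd : HasDerivAt (fun s => (inner ℝ (deriv γ s) n : ℝ))
      (inner ℝ (deriv (deriv γ) s0) n) s0 := by
    simpa using (hd2 s0).hasDerivAt.inner ℝ (hasDerivAt_const s0 n)
  have hne : (inner ℝ (deriv (deriv γ) s0) n : ℝ) ≠ 0 := by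
    intro h1
    rw [complex_inner] at h0 h1
    have hc := (hcurv s0).ne'
    apply hn
    apply Complex.ext
    · exact (mul_eq_zero.1 (by linear_combination (deriv (deriv γ) s0).im * h0 -
        (deriv γ s0).im * h1 : ((deriv γ s0).re * (deriv (deriv γ) s0).im -
          (deriv γ s0).im * (deriv (deriv γ) s0).re) * n.re = 0)).resolve_left hc
    · exact (mul_eq_zero.1 (by linear_combination (deriv γ s0).re * h1 -
        (deriv (deriv γ) s0).re * h0 : ((deriv γ s0).re * (deriv (deriv γ) s0).im -
          (deriv γ s0).im * (deriv (deriv γ) s0).re) * n.im = 0)).resolve_left hc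
  have hev := hdd.eventually_ne (c := 0) hne
  obtain ⟨s, h1, h2⟩ := (hfreq.and_eventually hev).exists
  exact h2 (hzero s h1)

/-- Convex bodies of class `C²₊` have only one normal direction at each boundary point. -/
lemma IsC2Plus.normal_unique (hK : IsC2Plus K) (h0 : (0 : ℂ) ∈ interior K) {n n' p : ℂ}
    (hn : n ≠ 0) (hn' : n' ≠ 0) (hp : IsSupportPoint K n p) (hp' : IsSupportPoint K n' p) :
    ∃ r : ℝ, 0 < r ∧ n' = r * n := by
  obtain ⟨γ, L, hL, hγ, hper, -, hr, hcurv⟩ := hK.boundary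
  have hd1 : Differentiable ℝ γ := hγ.differentiable (by norm_num)
  obtain ⟨s, rfl⟩ : p ∈ range γ := hr ▸ hp.mem_frontier hn
  have e1 := inner_deriv_eq_zero hK.compact.isClosed hd1 hr hp
  have e2 := inner_deriv_eq_zero hK.compact.isClosed hd1 hr hp'
  have hc := hcurv s
  rw [complex_inner] at e1 e2
  -- Both normals are orthogonal to the nonzero tangent `γ' s`, hence parallel.
  have hcross : n.re * n'.im - n.im * n'.re = 0 := by
    by_contra hne
    have k1 : (n.re * n'.im - n.im * n'.re) * (deriv γ s).re = 0 := by
      linear_combination n'.im * e1 - n.im * e2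
    have k2 : (n.re * n'.im - n.im * n'.re) * (deriv γ s).im = 0 := by
      linear_combination n.re * e2 - n'.re * e1
    have h1 := (mul_eq_zero.1 k1).resolve_left hne
    have h2 := (mul_eq_zero.1 k2).resolve_left hne
    simp [h1, h2] at hc
  have him : (n' / n).im = 0 := by
    rw [Complex.div_im, ← sub_div, div_eq_zero_iff]
    left
    linear_combination hcross
  have hr' : n' = ((n' / n).re : ℂ) * n := by
    have : n' / n = ((n' / n).re : ℂ) := Complex.ext (by simp) (by simp [him])
    rw [← this, div_mul_cancel₀ _ hn]
  refine ⟨(n' / n).re, ?_, hr'⟩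
  set r := (n' / n).re
  by_contra hle
  push Not at hle
  have hr0 : r ≠ 0 := fun h => hn' (by rw [hr', h]; simp)
  have hneg : r < 0 := lt_of_le_of_ne hle hr0
  -- Since `0` is interior, both support values at `γ s` are positive, which excludes a negative
  -- ratio.
  obtain ⟨ε, hε, hm⟩ := exists_pos_smul_mem h0 n
  rw [zero_add] at hm
  obtain ⟨δ, hδ, hm'⟩ := exists_pos_smul_mem h0 n'
  rw [zero_add] at hm'
  have a1 := hp.2 _ hm
  have a2 := hp'.2 _ hm'
  rw [real_inner_smul_left, real_inner_self_eq_norm_sq] at a1 a2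
  have b1 : 0 < ε * ‖n‖ ^ 2 := by positivity
  have b2 : 0 < δ * ‖n'‖ ^ 2 := by positivity
  have e3 : (inner ℝ (γ s) n' : ℝ) = r * inner ℝ (γ s) n := by
    rw [hr', ← Complex.real_smul, real_inner_smul_right]
  nlinarith

/-- By compactness it suffices to identify cluster points; each is a support point for the limit
normal, and that point is unique. -/
lemma IsC2Plus.continuousAt_piK (hK : IsC2Plus K) (h0 : K.Nonempty) {n : ℂ} (hn : n ≠ 0) :
    ContinuousAt (piK K) n := by
  have hev : ∀ᶠ m in 𝓝 n, m ≠ 0 := isOpen_ne.mem_nhds hn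
  refine hK.compact.tendsto_nhds_of_unique_mapClusterPt
    (hev.mono fun m hm => (isSupportPoint_piK hK.compact h0 hm).1) fun p hp hcl => ?_
  refine hK.supportPoint_unique hn ⟨hp, fun q hq => ?_⟩ (isSupportPoint_piK hK.compact h0 hn)
  obtain ⟨U, hU, hUp⟩ := mapClusterPt_iff_ultrafilter.1 hcl
  have hid : Tendsto (fun m : ℂ => m) U (𝓝 n) := hU
  exact le_of_tendsto_of_tendsto (tendsto_const_nhds.inner hid) (hUp.inner hid)
    ((hev.filter_mono hU).mono fun m hm => (isSupportPoint_piK hK.compact h0 hm).2 q hq)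

/-- Equality would make `n` and `n'` both normal at the same boundary point. -/
lemma IsC2Plus.inner_piK_lt (hK : IsC2Plus K) (h0 : (0 : ℂ) ∈ interior K) {n n' : ℂ}
    (hn : n ≠ 0) (hn' : n' ≠ 0) (h : ∀ r : ℝ, n' ≠ r * n) :
    (inner ℝ (piK K n') n : ℝ) < inner ℝ (piK K n) n := by
  have hne : K.Nonempty := ⟨0, interior_subset h0⟩
  have h1 := isSupportPoint_piK hK.compact hne hn
  have h2 := isSupportPoint_piK hK.compact hne hn'
  refine lt_of_le_of_ne (h1.2 _ h2.1) fun he => ?_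
  have h3 : IsSupportPoint K n (piK K n') := ⟨h2.1, fun q hq => he ▸ h1.2 q hq⟩
  obtain ⟨r, -, hr⟩ := hK.normal_unique h0 hn hn' h3 h2
  exact h r hr

lemma inner_mul_mul (a b v : ℂ) :
    (inner ℝ (a * v) (b * v) : ℝ) = Complex.normSq v * inner ℝ a b := by
  simp only [complex_inner, Complex.mul_re, Complex.mul_im, Complex.normSq_apply]; ring

/-- The component along `J v` of the boundary point of `K` with normal `J (v (c + e))`. -/
def height (K : Set ℂ) (v e : ℂ) (c : ℝ) : ℝ :=
  inner ℝ (piK K (Complex.I * (v * (c + e)))) (Complex.I * v)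

lemma normal_ne_zero {v e : ℂ} (hv : v ≠ 0) (he : e.im ≠ 0) (c : ℝ) :
    Complex.I * (v * (c + e)) ≠ 0 := by
  refine mul_ne_zero Complex.I_ne_zero (mul_ne_zero hv fun h => he ?_)
  simpa using congrArg Complex.im h

lemma IsC2Plus.continuous_height (hK : IsC2Plus K) (h0 : K.Nonempty) {v e : ℂ} (hv : v ≠ 0)
    (he : e.im ≠ 0) : Continuous (height K v e) := by
  refine continuous_iff_continuousAt.2 fun c => ContinuousAt.inner ?_ continuousAt_const
  exact ContinuousAt.comp (f := fun c : ℝ => Complex.I * (v * (c + e)))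
    (hK.continuousAt_piK h0 (normal_ne_zero hv he c)) (by fun_prop)

/-- The normals for `c` and `c'` differ by `(c' - c) J v`. Adding the strict support inequalities at
the two points leaves `(c' - c)` times the difference of heights, which is therefore positive. The
condition on `e` keeps the normals from being parallel; `e = ±I` serves the two half-planes. -/
lemma IsC2Plus.strictMono_height (hK : IsC2Plus K) (h0 : (0 : ℂ) ∈ interior K) {v e : ℂ}
    (hv : v ≠ 0) (he : e.im ≠ 0) : StrictMono (height K v e) := by
  intro c c' hc
  have hne : K.Nonempty := ⟨0, interior_subset h0⟩
  have hn := normal_ne_zero hv he c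
  have hn' := normal_ne_zero hv he c'
  have split : ∀ (q : ℂ) (c : ℝ), (inner ℝ q (Complex.I * (v * (c + e))) : ℝ) =
      c * inner ℝ q (Complex.I * v) + inner ℝ q (Complex.I * v * e) := fun q c => by
    rw [← real_inner_smul_right, ← inner_add_right, Complex.real_smul]; ring_nf
  have hpar : ∀ a b : ℝ, a ≠ b → ∀ r : ℝ,
      Complex.I * (v * (b + e)) ≠ r * (Complex.I * (v * (a + e))) := by
    intro a b hab r h
    have h2 : (b + e : ℂ) = r * (a + e) := by
      have : Complex.I * v ≠ 0 := mul_ne_zero Complex.I_ne_zero hv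
      apply mul_left_cancel₀ this
      linear_combination h
    have h3 := congrArg Complex.im h2
    have h4 := congrArg Complex.re h2
    simp at h3 h4
    have hr : r = 1 := by
      have := mul_right_cancel₀ he (show 1 * e.im = r * e.im by linarith)
      exact this.symm
    subst hr
    apply hab; linarith
  have h1 := hK.inner_piK_lt h0 hn hn' (hpar c c' hc.ne)
  have h2 := hK.inner_piK_lt h0 hn' hn (hpar c' c hc.ne')
  rw [split, split] at h1 h2
  unfold height
  nlinarith

lemma exp_eq (a : ℝ) : Complex.exp (a * Complex.I) = Real.cos a + Real.sin a * Complex.I := by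
  rw [Complex.exp_mul_I]; push_cast; ring

/-- Intermediate value theorem for the `J v`-component on `[π, 2π]`: the normals at the ends are `-J
v` and `J v`, so the end values are the extremes over `K`, and the value at `a` lies strictly
between them. Existence alone suffices for the chosen angle to have the property. -/
lemma IsC2Plus.isConjAngle_conjAngle (hK : IsC2Plus K) (h0 : (0 : ℂ) ∈ interior K) {v : ℂ}
    (hv : v ≠ 0) {a : ℝ} (ha : a ∈ Ioo 0 Real.pi) : IsConjAngle K v a (conjAngle K v a) := by
  have hne : K.Nonempty := ⟨0, interior_subset h0⟩
  apply Classical.epsilon_spec (p := fun b => IsConjAngle K v a b)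
  have hIv : Complex.I * v ≠ 0 := mul_ne_zero Complex.I_ne_zero hv
  have hne' : ∀ b : ℝ, Complex.I * turn v b ≠ 0 := fun b =>
    mul_ne_zero Complex.I_ne_zero (mul_ne_zero hv (Complex.exp_ne_zero _))
  set h : ℝ → ℝ := fun b => inner ℝ (piK K (Complex.I * turn v b)) (Complex.I * v) with hh
  have hcont : Continuous h := by
    refine continuous_iff_continuousAt.2 fun c => ContinuousAt.inner ?_ continuousAt_const
    exact ContinuousAt.comp (f := fun b : ℝ => Complex.I * turn v b)
      (hK.continuousAt_piK hne (hne' c)) (by unfold turn; fun_prop)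
  have hsin : Real.sin a ≠ 0 := (Real.sin_pos_of_mem_Ioo ha).ne'
  have hpar : ∀ r : ℝ, Complex.I * turn v a ≠ r * (Complex.I * v) := by
    intro r hr
    have : Complex.exp (a * Complex.I) = r := by
      apply mul_left_cancel₀ hIv
      unfold turn at hr
      linear_combination hr
    apply hsin
    have h2 := congrArg Complex.im this
    rwa [Complex.exp_ofReal_mul_I_im, Complex.ofReal_im] at h2
  have e1 : Complex.I * turn v Real.pi = -(Complex.I * v) := by
    simp [turn, Complex.exp_pi_mul_I]
  have e2 : Complex.I * turn v (2 * Real.pi) = Complex.I * v := by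
    simp [turn, Complex.exp_two_pi_mul_I]
  have l1 : h Real.pi < h a := by
    have := hK.inner_piK_lt h0 (neg_ne_zero.2 hIv) (hne' a) fun r hr =>
      hpar (-r) (by rw [hr]; push_cast; ring)
    rw [inner_neg_right, inner_neg_right] at this
    simp only [hh, e1]
    linarith
  have l2 : h a < h (2 * Real.pi) := by
    have := hK.inner_piK_lt h0 hIv (hne' a) hpar
    simpa only [hh, e2] using this
  obtain ⟨b, hb, hba⟩ := intermediate_value_Ioo (by linarith [Real.pi_pos])
    hcont.continuousOn ⟨l1, l2⟩
  -- Equal `J v`-components make the difference orthogonal to `J v`, so its quotient by `v` is real.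
  refine ⟨b, hb, ((piK K (Complex.I * turn v a) - piK K (Complex.I * turn v b)) / v).re, ?_⟩
  set w := piK K (Complex.I * turn v a) - piK K (Complex.I * turn v b) with hw
  have hw0 : (inner ℝ w (Complex.I * v) : ℝ) = 0 := by
    rw [hw, inner_sub_left]; simp only [hh] at hba; linarith
  have hwv : w = w / v * v := (div_mul_cancel₀ _ hv).symm
  have him : (w / v).im = 0 := by
    rw [hwv, inner_mul_mul, complex_inner] at hw0
    simpa [hv] using hw0
  conv_lhs => rw [hwv]
  congr 1
  exact Complex.ext (by simp) (by simp [him])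

/-- With `σ` the sign of `sin a` the first factor is positive and is ignored by `piK`, so angles can
be traded for slopes. -/
lemma turn_eq_of_sin_ne_zero (v : ℂ) {a : ℝ} (ha : Real.sin a ≠ 0) (σ : ℝ) (hσ : σ * σ = 1) :
    turn v a = (σ * Real.sin a : ℝ) * (v * ((σ * (Real.cos a / Real.sin a) : ℝ) + σ * Complex.I)) := by
  have h1 : (σ : ℂ) * σ = 1 := by exact_mod_cast hσ
  have h2 : (Real.sin a : ℂ) ≠ 0 := by exact_mod_cast ha
  rw [turn, exp_eq]
  push_cast at h2 ⊢
  field_simp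
  linear_combination (-v * (Complex.cos a + Complex.I * Complex.sin a)) * h1

end C2Plus

/-! ### Monotone rulings of the plane -/

lemma monotone_of_strictMono_comp {g H c : ℝ → ℝ} (hg : StrictMono g) (hH : Monotone H)
    (h : ∀ lam, g (c lam) = H lam) : Monotone c := fun a b hab =>
  hg.le_iff_le.1 (by rw [h, h]; exact hH hab)

/-- Continuity of `c` is not among the hypotheses. The intermediate value theorem is applied to `g
((x - lam) / y) - H lam`, whose zeros are the solutions of `c lam = (x - lam) / y`. -/
lemma exists_add_mul_eq {g H c : ℝ → ℝ} (hg : StrictMono g) (hgc : Continuous g)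
    (hH : Monotone H) (hHc : Continuous H) (h : ∀ lam, g (c lam) = H lam) {y : ℝ} (hy : 0 ≤ y)
    (x : ℝ) : ∃ lam, lam + y * c lam = x := by
  rcases hy.eq_or_lt with rfl | hy
  · exact ⟨x, by simp⟩
  set F : ℝ → ℝ := fun lam => g ((x - lam) / y) - H lam with hF
  have hFc : Continuous F := by fun_prop
  obtain ⟨lam, hl⟩ : (0 : ℝ) ∈ range F := by
    -- Comparison with `lam = 0`: beyond both `0` and `x - y * c 0` one has `(x - lam) / y ≤ c 0`
    -- and `H lam ≥ H 0 = g (c 0)`; the other end is symmetric.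
    refine mem_range_of_exists_le_of_exists_ge hFc ⟨max 0 (x - y * c 0), ?_⟩
      ⟨min 0 (x - y * c 0), ?_⟩
    · have h1 : g ((x - max 0 (x - y * c 0)) / y) ≤ g (c 0) := hg.monotone (by
        rw [div_le_iff₀ hy]; linarith [le_max_right 0 (x - y * c 0)])
      have h2 := hH (le_max_left 0 (x - y * c 0))
      rw [h] at h1
      simp only [hF]; linarith
    · have h1 : g (c 0) ≤ g ((x - min 0 (x - y * c 0)) / y) := hg.monotone (by
        rw [le_div_iff₀ hy]; linarith [min_le_right 0 (x - y * c 0)])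
      have h2 := hH (min_le_left 0 (x - y * c 0))
      rw [h] at h1
      simp only [hF]; linarith
  refine ⟨lam, ?_⟩
  have h3 : g ((x - lam) / y) = g (c lam) := by rw [h]; simp only [hF] at hl; linarith
  have h4 := hg.injective h3
  rw [div_eq_iff hy.ne'] at h4
  linarith

/-- The abscissa at height `y` of the half-line that starts at `lam` and has slope parameter
`cp lam` in the upper half-plane and `cm lam` in the lower one. -/
def rayAbscissa (cp cm : ℝ → ℝ) (y lam : ℝ) : ℝ :=
  lam + (max y 0 * cp lam + max (-y) 0 * cm lam)

/-- The foot on the real axis of the half-line through `x + i y`. -/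
def foot (cp cm : ℝ → ℝ) (x y : ℝ) : ℝ := Classical.epsilon fun lam => rayAbscissa cp cm y lam = x

/-- The slopes `cp`, `cm` are monotone and the half-lines with these slopes cover the plane. -/
structure IsRuling (cp cm : ℝ → ℝ) : Prop where
  mono_pos : Monotone cp
  mono_neg : Monotone cm
  cover_pos : ∀ y : ℝ, 0 ≤ y → ∀ x, ∃ lam, lam + y * cp lam = x
  cover_neg : ∀ y : ℝ, 0 ≤ y → ∀ x, ∃ lam, lam + y * cm lam = x

namespace IsRuling

variable {cp cm : ℝ → ℝ}

lemma rayAbscissa_foot (h : IsRuling cp cm) (x y : ℝ) : rayAbscissa cp cm y (foot cp cm x y) = x := by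
  apply Classical.epsilon_spec (p := fun lam => rayAbscissa cp cm y lam = x)
  rcases le_total 0 y with hy | hy
  · obtain ⟨l, hl⟩ := h.cover_pos y hy x
    exact ⟨l, by rw [rayAbscissa, max_eq_left hy, max_eq_right (by linarith)]; linarith⟩
  · obtain ⟨l, hl⟩ := h.cover_neg (-y) (by linarith) x
    exact ⟨l, by rw [rayAbscissa, max_eq_right hy, max_eq_left (by linarith)]; linarith⟩

/-- Monotone slopes make the half-lines spread apart. This gives uniqueness of the foot and its
Lipschitz dependence on `x`. -/
lemma sub_le_rayAbscissa_sub (h : IsRuling cp cm) (y : ℝ) {a b : ℝ} (hab : a ≤ b) :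
    b - a ≤ rayAbscissa cp cm y b - rayAbscissa cp cm y a := by
  have h1 := mul_le_mul_of_nonneg_left (h.mono_pos hab) (le_max_right y 0)
  have h2 := mul_le_mul_of_nonneg_left (h.mono_neg hab) (le_max_right (-y) 0)
  unfold rayAbscissa
  linarith

lemma abs_sub_le (h : IsRuling cp cm) (y a b : ℝ) :
    |a - b| ≤ |rayAbscissa cp cm y a - rayAbscissa cp cm y b| := by
  rcases le_total a b with hab | hab
  · rw [abs_sub_comm, abs_sub_comm (rayAbscissa cp cm y a), abs_of_nonneg (sub_nonneg.2 hab)]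
    exact (h.sub_le_rayAbscissa_sub y hab).trans (le_abs_self _)
  · rw [abs_of_nonneg (sub_nonneg.2 hab)]
    exact (h.sub_le_rayAbscissa_sub y hab).trans (le_abs_self _)

lemma foot_eq (h : IsRuling cp cm) {x y lam : ℝ} (hl : rayAbscissa cp cm y lam = x) : foot cp cm x y = lam := by
  have := h.abs_sub_le y (foot cp cm x y) lam
  rw [h.rayAbscissa_foot, hl, sub_self, abs_zero] at this
  exact sub_eq_zero.1 (abs_nonpos_iff.1 this)

lemma foot_zero (h : IsRuling cp cm) (x : ℝ) : foot cp cm x 0 = x := h.foot_eq (by simp [rayAbscissa])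

lemma monotone_foot (h : IsRuling cp cm) (y : ℝ) : Monotone fun x => foot cp cm x y := by
  intro x x' hx
  by_contra hlt
  push Not at hlt
  have := h.sub_le_rayAbscissa_sub y hlt.le
  rw [h.rayAbscissa_foot, h.rayAbscissa_foot] at this
  linarith

lemma abs_rayAbscissa_sub_le (y y' lam : ℝ) :
    |rayAbscissa cp cm y lam - rayAbscissa cp cm y' lam| ≤ |y - y'| * (|cp lam| + |cm lam|) := by
  have e : rayAbscissa cp cm y lam - rayAbscissa cp cm y' lam =
    (max y 0 - max y' 0) * cp lam + (max (-y) 0 - max (-y') 0) * cm lam := by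
    unfold rayAbscissa; ring
  have h1 := abs_max_sub_max_le_abs y y' 0
  have h2 := abs_max_sub_max_le_abs (-y) (-y') 0
  have h3 : |(-y) - (-y')| = |y - y'| := by rw [← abs_neg]; ring_nf
  rw [h3] at h2
  rw [e, mul_add]
  refine (abs_add_le _ _).trans ?_
  rw [abs_mul, abs_mul]
  gcongr

/-- The half-line through `(x, y)` is followed to height `y'`, where its abscissa has moved by at
most `|y - y'|` times a slope; at a fixed height, feet are no farther apart than abscissas. -/
lemma abs_foot_sub_le (h : IsRuling cp cm) (x x' y y' : ℝ) :
    |foot cp cm x y - foot cp cm x' y'| ≤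
      |x - x'| + |y - y'| * (|cp (foot cp cm x y)| + |cm (foot cp cm x y)|) := by
  have h1 := h.abs_sub_le y' (foot cp cm x y) (foot cp cm x' y')
  have h2 := abs_rayAbscissa_sub_le (cp := cp) (cm := cm) y' y (foot cp cm x y)
  have h3 := abs_add_le (rayAbscissa cp cm y (foot cp cm x y) - rayAbscissa cp cm y' (foot cp cm x' y'))
    (rayAbscissa cp cm y' (foot cp cm x y) - rayAbscissa cp cm y (foot cp cm x y))
  rw [h.rayAbscissa_foot, h.rayAbscissa_foot] at h3
  rw [h.rayAbscissa_foot] at h1 h2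
  rw [abs_sub_comm y' y] at h2
  have e : x - x' + (rayAbscissa cp cm y' (foot cp cm x y) - x) =
    rayAbscissa cp cm y' (foot cp cm x y) - x' := by ring
  rw [e] at h3
  linarith

lemma abs_foot_le (h : IsRuling cp cm) (x y : ℝ) : |foot cp cm x y| ≤ |x| + |y| * (|cp 0| + |cm 0|) := by
  have := h.abs_foot_sub_le 0 x 0 y
  rw [h.foot_zero] at this
  simpa using this

end IsRuling

lemma Monotone.abs_le_of_abs_le {c : ℝ → ℝ} (hc : Monotone c) {a r : ℝ} (ha : |a| ≤ r) :
    |c a| ≤ |c r| + |c (-r)| := by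
  have h1 := hc (abs_le.1 ha).1
  have h2 := hc (abs_le.1 ha).2
  have h3 := neg_abs_le (c (-r))
  have h4 := le_abs_self (c r)
  rw [abs_le]
  constructor <;> linarith [abs_nonneg (c r), abs_nonneg (c (-r))]

/-! ### The ruled graph -/

/-- The function whose graph is the union of the horizontal half-lines with feet `lam v` and
slopes `cp`, `cm` relative to `v`. -/
def ruledHeight (v : ℂ) (cp cm : ℝ → ℝ) (z : ℂ) : ℝ :=
  -(Complex.normSq v * ((z / v).im * foot cp cm (z / v).re (z / v).im))

lemma IsRuling.lipschitzOnWith_ruledHeight {cp cm : ℝ → ℝ} (h : IsRuling cp cm) (v : ℂ) (R : ℝ) :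
    ∃ C : ℝ≥0, LipschitzOnWith C (ruledHeight v cp cm) (Metric.closedBall 0 R) := by
  -- On the ball, `r` bounds the coordinates of `z / v`, `ρ` bounds the feet, and `B` bounds the
  -- slopes at those feet by monotonicity.
  set r := R / ‖v‖ with hr
  set ρ := r + r * (|cp 0| + |cm 0|) with hρ
  set B := (|cp ρ| + |cp (-ρ)|) + (|cm ρ| + |cm (-ρ)|) with hB
  refine ⟨_, LipschitzOnWith.of_dist_le' (K := Complex.normSq v * ((ρ + r * (1 + B)) / ‖v‖))
    fun z hz z' hz' => ?_⟩
  have hb : ∀ z ∈ Metric.closedBall (0 : ℂ) R, |(z / v).re| ≤ r ∧ |(z / v).im| ≤ r := by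
    intro z hz
    have : ‖z / v‖ ≤ r := by
      rw [norm_div]
      exact div_le_div_of_nonneg_right (by simpa using hz) (norm_nonneg _)
    exact ⟨(Complex.abs_re_le_norm _).trans this, (Complex.abs_im_le_norm _).trans this⟩
  have hr0 : 0 ≤ r := (abs_nonneg _).trans (hb z hz).1
  have hfoot : ∀ z ∈ Metric.closedBall (0 : ℂ) R, |foot cp cm (z / v).re (z / v).im| ≤ ρ := by
    intro z hz
    refine (h.abs_foot_le _ _).trans ?_
    have := hb z hz
    rw [hρ]
    gcongr
    · exact this.1
    · exact this.2
  set δ := dist z z' / ‖v‖ with hδ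
  have hd : ‖z / v - z' / v‖ = δ := by rw [← sub_div, norm_div, hδ, dist_eq_norm]
  have h1 : |(z / v).re - (z' / v).re| ≤ δ := by
    rw [← hd, ← Complex.sub_re]; exact Complex.abs_re_le_norm _
  have h2 : |(z / v).im - (z' / v).im| ≤ δ := by
    rw [← hd, ← Complex.sub_im]; exact Complex.abs_im_le_norm _
  have hδ0 : 0 ≤ δ := by positivity
  have h3 : |foot cp cm (z / v).re (z / v).im - foot cp cm (z' / v).re (z' / v).im| ≤
      δ * (1 + B) := by
    refine (h.abs_foot_sub_le _ _ _ _).trans ?_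
    have k1 := Monotone.abs_le_of_abs_le h.mono_pos (hfoot z hz)
    have k2 := Monotone.abs_le_of_abs_le h.mono_neg (hfoot z hz)
    calc _ ≤ δ + δ * B := by
          rw [hB]; gcongr
      _ = _ := by ring
  have hρ0 : 0 ≤ ρ := by positivity
  unfold ruledHeight
  set a := (z / v).im
  set a' := (z' / v).im
  set f := foot cp cm (z / v).re a
  set f' := foot cp cm (z' / v).re a'
  have e : -(Complex.normSq v * (a * f)) - -(Complex.normSq v * (a' * f')) =
    -(Complex.normSq v * ((a - a') * f + a' * (f - f'))) := by ring
  rw [Real.dist_eq, e, abs_neg, abs_mul, abs_of_nonneg (Complex.normSq_nonneg v)]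
  have h4 : |(a - a') * f + a' * (f - f')| ≤ δ * ρ + r * (δ * (1 + B)) := by
    refine (abs_add_le _ _).trans ?_
    rw [abs_mul, abs_mul]
    have := hfoot z hz
    have := (hb z' hz').2
    gcongr
  calc Complex.normSq v * |(a - a') * f + a' * (f - f')|
      ≤ Complex.normSq v * (δ * ρ + r * (δ * (1 + B))) :=
        mul_le_mul_of_nonneg_left h4 (Complex.normSq_nonneg v)
    _ = _ := by rw [hδ]; ring

lemma IsRuling.locallyLipschitz_ruledHeight {cp cm : ℝ → ℝ} (h : IsRuling cp cm) (v : ℂ) :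
    LocallyLipschitz (ruledHeight v cp cm) := by
  intro z
  obtain ⟨C, hC⟩ := h.lipschitzOnWith_ruledHeight v (‖z‖ + 1)
  refine ⟨C, _, ?_, hC⟩
  refine mem_of_superset (Metric.ball_mem_nhds z one_pos) fun y hy => ?_
  rw [mem_closedBall_zero_iff]
  have := norm_le_norm_add_norm_sub' y z
  rw [Metric.mem_ball, dist_eq_norm] at hy
  linarith

/-- In the coordinate `z / v`, horizontality makes `t` equal to `-|v|²` times the ordinate times the
foot, for every direction of the half-line; this is the formula of `ruledHeight`. -/
lemma mem_horizontalRay_iff {v : ℂ} (hv : v ≠ 0) (lam a : ℝ) (p : Heis) :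
    p ∈ horizontalRay ((lam : ℂ) * v) (turn v a) ↔
      ∃ μ : ℝ, 0 ≤ μ ∧ (p.1 / v).re = lam + μ * Real.cos a ∧ (p.1 / v).im = μ * Real.sin a ∧
        p.2 = -(Complex.normSq v * (μ * Real.sin a * lam)) := by
  unfold horizontalRay
  refine exists_congr fun μ => and_congr_right fun _ => ?_
  have ht : μ * (((lam : ℂ) * v).im * (turn v a).re - ((lam : ℂ) * v).re * (turn v a).im) =
      -(Complex.normSq v * (μ * Real.sin a * lam)) := by
    rw [turn, exp_eq]
    simp only [Complex.mul_re, Complex.mul_im, Complex.add_re, Complex.add_im, Complex.ofReal_re,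
      Complex.ofReal_im, Complex.I_re, Complex.I_im, Complex.normSq_apply]
    ring
  have hz : p.1 = (lam : ℂ) * v + (μ : ℂ) * turn v a ↔
      (p.1 / v).re = lam + μ * Real.cos a ∧ (p.1 / v).im = μ * Real.sin a := by
    have : (lam : ℂ) * v + (μ : ℂ) * turn v a = (lam + μ * Complex.exp (a * Complex.I)) * v := by
      rw [turn]; ring
    rw [this, ← div_eq_iff hv, Complex.ext_iff]
    simp [Complex.exp_ofReal_mul_I_re, Complex.exp_ofReal_mul_I_im]
  rw [Prod.ext_iff]
  simp only
  rw [ht, hz, and_assoc]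

lemma IsRuling.iUnion_horizontalRay_eq {cp cm : ℝ → ℝ} (h : IsRuling cp cm) {v : ℂ} (hv : v ≠ 0)
    {a b : ℝ → ℝ} (ha : ∀ lam, 0 < Real.sin (a lam)) (hb : ∀ lam, Real.sin (b lam) < 0)
    (hcp : ∀ lam, cp lam = Real.cos (a lam) / Real.sin (a lam))
    (hcm : ∀ lam, cm lam = -(Real.cos (b lam) / Real.sin (b lam))) :
    (⋃ lam : ℝ, horizontalRay ((lam : ℂ) * v) (turn v (a lam)) ∪
      horizontalRay ((lam : ℂ) * v) (turn v (b lam))) = tGraph (ruledHeight v cp cm) := by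
  ext p
  simp only [mem_iUnion, mem_union, mem_horizontalRay_iff hv, tGraph, mem_ofPred_eq]
  constructor
  · rintro ⟨lam, ⟨μ, hμ, h1, h2, h3⟩ | ⟨μ, hμ, h1, h2, h3⟩⟩
    · have : foot cp cm (p.1 / v).re (p.1 / v).im = lam := h.foot_eq (by
        have hn : 0 ≤ μ * Real.sin (a lam) := mul_nonneg hμ (ha lam).le
        rw [rayAbscissa, h1, h2, max_eq_left hn, max_eq_right (by linarith), hcp]
        field_simp [(ha lam).ne']
        ring)
      rw [ruledHeight, this, h2, h3]
    · have : foot cp cm (p.1 / v).re (p.1 / v).im = lam := h.foot_eq (by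
        have hn : μ * Real.sin (b lam) ≤ 0 := mul_nonpos_of_nonneg_of_nonpos hμ (hb lam).le
        rw [rayAbscissa, h1, h2, max_eq_right hn, max_eq_left (by linarith), hcm]
        field_simp [(hb lam).ne]
        ring)
      rw [ruledHeight, this, h2, h3]
  · intro hp
    set lam := foot cp cm (p.1 / v).re (p.1 / v).im with hlam
    have hfoot := h.rayAbscissa_foot (p.1 / v).re (p.1 / v).im
    rw [← hlam, rayAbscissa] at hfoot
    refine ⟨lam, ?_⟩
    rcases le_total 0 (p.1 / v).im with hy | hy
    · left
      have hs := (ha lam).ne'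
      rw [max_eq_left hy, max_eq_right (by linarith), hcp] at hfoot
      have e : (p.1 / v).im / Real.sin (a lam) * Real.sin (a lam) = (p.1 / v).im :=
        div_mul_cancel₀ _ hs
      refine ⟨(p.1 / v).im / Real.sin (a lam), div_nonneg hy (ha lam).le, ?_, e.symm, ?_⟩
      · rw [← hfoot]; field_simp; ring
      · rw [e, hp, ruledHeight]
    · right
      have hs := (hb lam).ne
      rw [max_eq_right hy, max_eq_left (by linarith), hcm] at hfoot
      have e : (p.1 / v).im / Real.sin (b lam) * Real.sin (b lam) = (p.1 / v).im :=
        div_mul_cancel₀ _ hs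
      refine ⟨(p.1 / v).im / Real.sin (b lam), div_nonneg_of_nonpos hy (hb lam).le, ?_, e.symm, ?_⟩
      · rw [← hfoot]; field_simp; ring
      · rw [e, hp, ruledHeight]

/-! ### The convex potential -/

/-- `Φ` is a field of subgradients of `ψ`, turned by a right angle, with values in `K`. -/
structure IsRotatedSubgradient (K : Set ℂ) (ψ : ℂ → ℝ) (Φ : ℂ → ℂ) : Prop where
  mem : ∀ z, Φ z ∈ K
  le : ∀ z z', ψ z + inner ℝ (Φ z) (Complex.I * (z' - z)) ≤ ψ z'

/-- The potential of the calibration by `Φ`, where `Λ` is the foot of the half-line through a point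
and `H` is the common value of `⟨Φ, J v⟩` on the two half-lines with the same foot. -/
def potential (v : ℂ) (Λ : ℂ → ℝ) (H : ℝ → ℝ) (Φ : ℂ → ℂ) (z : ℂ) : ℝ :=
  (∫ s in (0 : ℝ)..Λ z, H s) + inner ℝ (Φ z) (Complex.I * (z - Λ z * v))

/-- The support inequality at `z'` is tested with `Φ z ∈ K`. Writing `z' - Λ' v = (z' - z) + (z - Λ
v) + (Λ - Λ') v`, the last term contributes `(Λ - Λ') H(Λ)`, which the integral of the monotone `H`
from `Λ` to `Λ'` compensates. -/
lemma isRotatedSubgradient_potential {K : Set ℂ} {v : ℂ} {Λ : ℂ → ℝ} {H : ℝ → ℝ} {Φ : ℂ → ℂ}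
    (hH : Monotone H) (hΦ : ∀ z, IsSupportPoint K (Complex.I * (z - Λ z * v)) (Φ z))
    (hΦH : ∀ z, (inner ℝ (Φ z) (Complex.I * v) : ℝ) = H (Λ z)) :
    IsRotatedSubgradient K (potential v Λ H Φ) Φ := by
  refine ⟨fun z => (hΦ z).1, fun z z' => ?_⟩
  have hint : ∀ a b, IntervalIntegrable H volume a b := fun a b => hH.intervalIntegrable
  have h1 : (Λ z' - Λ z) * H (Λ z) ≤ ∫ s in Λ z..Λ z', H s := by
    rcases le_total (Λ z) (Λ z') with hle | hle
    · have := intervalIntegral.integral_mono_on hle (intervalIntegrable_const (c := H (Λ z)))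
        (hint _ _) fun s hs => hH hs.1
      simpa using this
    · have := intervalIntegral.integral_mono_on hle (hint _ _)
        (intervalIntegrable_const (c := H (Λ z))) fun s hs => hH hs.2
      rw [intervalIntegral.integral_symm]
      simp only [intervalIntegral.integral_const, smul_eq_mul] at this
      linarith
  have h2 := intervalIntegral.integral_add_adjacent_intervals (hint 0 (Λ z)) (hint (Λ z) (Λ z'))
  have h3 := (hΦ z').2 _ (hΦ z).1
  have e : Complex.I * (z' - Λ z' * v) = Complex.I * (z' - z) + Complex.I * (z - Λ z * v) +
      (Λ z - Λ z') • (Complex.I * v) := by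
    rw [Complex.real_smul]; push_cast; ring
  have h4 : (inner ℝ (Φ z) (Complex.I * (z' - Λ z' * v)) : ℝ) =
      inner ℝ (Φ z) (Complex.I * (z' - z)) + inner ℝ (Φ z) (Complex.I * (z - Λ z * v)) +
        (Λ z - Λ z') * H (Λ z) := by
    rw [e, inner_add_right, inner_add_right, real_inner_smul_right, hΦH]
  unfold potential
  rw [← h2]
  linarith

/-! ### Mollified potentials and their rotated gradients -/

/-- Mollification by a normalized bump function. -/
def mollify (ρ : ContDiffBump (0 : ℂ)) (ψ : ℂ → ℝ) : ℂ → ℝ :=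
  convolution (ρ.normed volume) ψ (ContinuousLinearMap.lsmul ℝ ℝ) volume

lemma contDiff_mollify (ρ : ContDiffBump (0 : ℂ)) {ψ : ℂ → ℝ} (hψ : Continuous ψ) :
    ContDiff ℝ 2 (mollify ρ ψ) :=
  ρ.hasCompactSupport_normed.contDiff_convolution_left _ (ρ.contDiff_normed (n := 2))
    hψ.locallyIntegrable

lemma integrable_mollify (ρ : ContDiffBump (0 : ℂ)) {ψ : ℂ → ℝ} (hψ : Continuous ψ) (z : ℂ) :
    Integrable fun t => ρ.normed volume t * ψ (z - t) :=
  (Continuous.mul ρ.continuous_normed (by fun_prop)).integrable_of_hasCompactSupport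
    ρ.hasCompactSupport_normed.mul_right

/-- Mollification preserves linear inequalities between translates. -/
lemma mollify_le_of_le (ρ : ContDiffBump (0 : ℂ)) {ψ : ℂ → ℝ} (hψ : Continuous ψ) {a b c B : ℝ}
    {h k : ℂ} (hle : ∀ z, a * ψ (z + h) + b * ψ z + c * ψ (z + k) ≤ B) (z : ℂ) :
    a * mollify ρ ψ (z + h) + b * mollify ρ ψ z + c * mollify ρ ψ (z + k) ≤ B := by
  have hm : ∀ z, mollify ρ ψ z = ∫ t, ρ.normed volume t * ψ (z - t) := fun z => by
    simp [mollify, convolution_def]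
  have hi := fun z => integrable_mollify ρ hψ z
  have h12 := ((hi (z + h)).const_mul a).add ((hi z).const_mul b)
  have h3 := (hi (z + k)).const_mul c
  have hsum := integral_add h12 h3
  simp only [Pi.add_apply] at hsum
  rw [integral_add ((hi (z + h)).const_mul a) ((hi z).const_mul b), integral_const_mul,
    integral_const_mul, integral_const_mul] at hsum
  rw [hm, hm, hm, ← hsum]
  have hB : ∫ t, ρ.normed volume t * B = B := by
    rw [integral_mul_const, ρ.integral_normed, one_mul]
  rw [← hB]
  refine integral_mono (h12.add h3) (ρ.integrable_normed.mul_const B) fun t => ?_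
  have h1 := mul_le_mul_of_nonneg_left (hle (z - t)) (ρ.nonneg_normed (μ := volume) t)
  have e1 : z + h - t = z - t + h := by ring
  have e2 : z + k - t = z - t + k := by ring
  simp only [e1, e2]
  linarith

lemma fderiv_le_of_forall {f : ℂ → ℝ} {z h : ℂ} (hf : DifferentiableAt ℝ f z) {B : ℝ}
    (hB : ∀ s : ℝ, 0 < s → f (z + s • h) - f z ≤ s * B) : fderiv ℝ f z h ≤ B := by
  have h1 : HasDerivAt (fun s : ℝ => f (z + s • h)) (fderiv ℝ f z h) 0 :=
    hf.hasFDerivAt.hasLineDerivAt h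
  refine le_of_tendsto h1.tendsto_slope_zero_right ?_
  filter_upwards [self_mem_nhdsWithin] with s hs
  have hs : 0 < s := hs
  rw [zero_add, zero_smul, add_zero, smul_eq_mul, inv_mul_le_iff₀ hs]
  exact hB s hs

namespace IsRotatedSubgradient

variable {K : Set ℂ} {ψ : ℂ → ℝ} {Φ : ℂ → ℂ}

lemma sub_le (hs : IsRotatedSubgradient K ψ Φ) {h : ℂ} {B : ℝ}
    (hB : ∀ q ∈ K, (inner ℝ q (Complex.I * h) : ℝ) ≤ B) (z : ℂ) : ψ (z + h) - ψ z ≤ B := by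
  have h1 := hs.le (z + h) z
  have h2 := hB _ (hs.mem (z + h))
  have e : Complex.I * (z - (z + h)) = -(Complex.I * h) := by ring
  rw [e, inner_neg_right] at h1
  linarith

lemma continuous (hs : IsRotatedSubgradient K ψ Φ) (hK : Bornology.IsBounded K) :
    Continuous ψ := by
  obtain ⟨R, hR⟩ := hK.exists_norm_le
  refine (LipschitzWith.of_le_add_mul R.toNNReal fun x y => ?_).continuous
  have := hs.sub_le (h := x - y) (B := R.toNNReal * dist x y) (fun q hq => ?_) y
  · rw [add_sub_cancel] at this; linarith
  · refine (real_inner_le_norm _ _).trans ?_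
    rw [norm_mul, Complex.norm_I, one_mul, dist_eq_norm]
    gcongr
    exact (hR q hq).trans (Real.le_coe_toNNReal R)

/-- A bound on all increments in direction `h` survives averaging. Over all `h` these bounds place
the rotated gradient in `K`. -/
lemma fderiv_mollify_le (hs : IsRotatedSubgradient K ψ Φ) (hK : Bornology.IsBounded K)
    (ρ : ContDiffBump (0 : ℂ)) (z : ℂ) {h : ℂ} {B : ℝ}
    (hB : ∀ q ∈ K, (inner ℝ q (Complex.I * h) : ℝ) ≤ B) :
    fderiv ℝ (mollify ρ ψ) z h ≤ B := by
  have hc := hs.continuous hK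
  refine fderiv_le_of_forall ((contDiff_mollify ρ hc).differentiable (by norm_num) z)
    fun s hs0 => ?_
  have := mollify_le_of_le ρ hc (a := 1) (b := -1) (c := 0) (B := s * B) (h := s • h) (k := 0)
    (fun x => ?_) z
  · linarith
  · have := hs.sub_le (h := s • h) (B := s * B) (fun q hq => ?_) x
    · linarith
    · rw [mul_smul_comm, real_inner_smul_right]
      exact mul_le_mul_of_nonneg_left (hB q hq) hs0.le

/-- Convexity: the derivative is at least the backward difference. The subgradient inequalities at
`x` towards `x + s h` and `x - h` combine into a three-point inequality in which `Φ` cancels, so it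
survives mollification with no measurability of `Φ`. -/
lemma le_fderiv_mollify (hs : IsRotatedSubgradient K ψ Φ) (hK : Bornology.IsBounded K)
    (ρ : ContDiffBump (0 : ℂ)) (z h : ℂ) :
    mollify ρ ψ z - mollify ρ ψ (z - h) ≤ fderiv ℝ (mollify ρ ψ) z h := by
  have hc := hs.continuous hK
  set c := mollify ρ ψ z - mollify ρ ψ (z - h) with hcdef
  have := fderiv_le_of_forall (f := fun x => -mollify ρ ψ x) (z := z) (h := h) (B := -c)
    ((contDiff_mollify ρ hc).differentiable (by norm_num) z).neg fun s hs0 => ?_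
  · rw [fderiv_fun_neg, neg_apply] at this
    linarith
  · have := mollify_le_of_le ρ hc (a := -1) (b := 1 + s) (c := -s) (B := 0) (h := s • h)
      (k := -h) (fun x => ?_) z
    · rw [hcdef, sub_eq_add_neg z h]; linarith
    · have h1 := hs.le x (x + s • h)
      have h2 := hs.le x (x + -h)
      have e1 : Complex.I * (x + s • h - x) = s • (Complex.I * h) := by
        rw [add_sub_cancel_left, mul_smul_comm]
      have e2 : Complex.I * (x + -h - x) = -(Complex.I * h) := by ring
      rw [e1, real_inner_smul_right] at h1
      rw [e2, inner_neg_right] at h2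
      nlinarith [mul_le_mul_of_nonneg_left h2 hs0.le]

end IsRotatedSubgradient

/-- The gradient of `f`, turned by a right angle. -/
def rotGrad (f : ℂ → ℝ) (z : ℂ) : ℂ :=
  (fderiv ℝ f z 1 : ℂ) * Complex.I - (fderiv ℝ f z Complex.I : ℂ)

lemma inner_rotGrad (f : ℂ → ℝ) (z h : ℂ) :
    (inner ℝ (rotGrad f z) (Complex.I * h) : ℝ) = fderiv ℝ f z h := by
  have : h = h.re • (1 : ℂ) + h.im • Complex.I := by
    simp [Complex.re_add_im]
  conv_rhs => rw [this, map_add, map_smul, map_smul]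
  simp [rotGrad]
  ring

lemma contDiff_rotGrad {f : ℂ → ℝ} (hf : ContDiff ℝ 2 f) : ContDiff ℝ 1 (rotGrad f) := by
  have h : ContDiff ℝ 1 (fderiv ℝ f) := hf.fderiv_right (by norm_num)
  have h1 : ∀ e : ℂ, ContDiff ℝ 1 fun z => (fderiv ℝ f z e : ℂ) := fun e =>
    Complex.ofRealCLM.contDiff.comp (h.clm_apply contDiff_const)
  exact ((h1 1).mul contDiff_const).sub (h1 Complex.I)

/-- On fields independent of `t`, `X` and `Y` act as `∂ₓ` and `∂ᵧ`, and the divergence of a rotated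
gradient is a difference of mixed second derivatives. -/
lemma hdiv_rotGrad {f : ℂ → ℝ} (hf : ContDiff ℝ 2 f) (p : Heis) :
    hdiv (fun p : Heis => rotGrad f p.1) p = 0 := by
  have h : ContDiff ℝ 1 (fderiv ℝ f) := hf.fderiv_right (by norm_num)
  have hd := (h.differentiable (by norm_num) p.1).hasFDerivAt
  have hc : HasFDerivAt (fun p : Heis => rotGrad f p.1)
      ((fderiv ℝ (rotGrad f) p.1).comp (ContinuousLinearMap.fst ℝ ℂ ℝ)) p :=
    HasFDerivAt.comp p ((contDiff_rotGrad hf).differentiable (by norm_num) p.1).hasFDerivAt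
      hasFDerivAt_fst
  have h1 : ∀ e : ℂ, HasFDerivAt (fun z => (fderiv ℝ f z e : ℂ)) _ p.1 := fun e =>
    Complex.ofRealCLM.hasFDerivAt.comp p.1 (hd.clm_apply (hasFDerivAt_const e p.1))
  have hr : HasFDerivAt (rotGrad f) _ p.1 := ((h1 1).mul_const Complex.I).sub (h1 Complex.I)
  have hsymm : IsSymmSndFDerivAt ℝ f p.1 :=
    hf.contDiffAt.isSymmSndFDerivAt (by simp)
  have := hsymm.eq 1 Complex.I
  rw [hdiv, hc.fderiv, hr.fderiv]
  simp [fieldX, fieldY, this]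

lemma mem_of_forall_inner_le {K : Set ℂ} (hK : Convex ℝ K) (hcl : IsClosed K) {w : ℂ}
    (hw : ∀ (h : ℂ) (B : ℝ), (∀ q ∈ K, (inner ℝ q (Complex.I * h) : ℝ) ≤ B) →
      (inner ℝ w (Complex.I * h) : ℝ) ≤ B) : w ∈ K := by
  by_contra hwK
  obtain ⟨l, s, h1, h2⟩ := geometric_hahn_banach_closed_point hK hcl hwK
  set n := (InnerProductSpace.toDual ℝ ℂ).symm l with hn
  have hl : ∀ x, l x = inner ℝ x n := fun x => by
    rw [real_inner_comm, hn, InnerProductSpace.toDual_symm_apply]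
  have e : Complex.I * (-Complex.I * n) = n := by
    rw [← mul_assoc]; simp
  have := hw (-Complex.I * n) s fun q hq => by rw [e, ← hl]; exact (h1 q hq).le
  rw [e, ← hl] at this
  linarith

lemma IsRotatedSubgradient.rotGrad_mollify_mem {K : Set ℂ} {ψ : ℂ → ℝ} {Φ : ℂ → ℂ}
    (hs : IsRotatedSubgradient K ψ Φ) (hK : IsCompact K) (hconv : Convex ℝ K)
    (ρ : ContDiffBump (0 : ℂ)) (z : ℂ) : rotGrad (mollify ρ ψ) z ∈ K :=
  mem_of_forall_inner_le hconv hK.isClosed fun h B hB => by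
    rw [inner_rotGrad]
    exact hs.fderiv_mollify_le hK.isBounded ρ z hB

/-- Along a segment on which the potential is affine, the derivative of the mollified potentials
converges. -/
lemma IsRotatedSubgradient.tendsto_fderiv_mollify {K : Set ℂ} {ψ : ℂ → ℝ} {Φ : ℂ → ℂ}
    (hs : IsRotatedSubgradient K ψ Φ) (hK : IsCompact K) {ρ : ℕ → ContDiffBump (0 : ℂ)}
    (hρ : Tendsto (fun n => (ρ n).rOut) atTop (𝓝 0)) {z h : ℂ}
    (hmax : IsSupportPoint K (Complex.I * h) (Φ z))
    (haff : ψ z - ψ (z - h) = inner ℝ (Φ z) (Complex.I * h)) :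
    Tendsto (fun n => fderiv ℝ (mollify (ρ n) ψ) z h) atTop
      (𝓝 (inner ℝ (Φ z) (Complex.I * h))) := by
  have hc := hs.continuous hK.isBounded
  have ht : ∀ x, Tendsto (fun n => mollify (ρ n) ψ x) atTop (𝓝 (ψ x)) := fun x =>
    ContDiffBump.convolution_tendsto_right_of_continuous hρ hc x
  -- The lower bound comes from convexity and converges by affinity of `ψ` on the segment; the upper
  -- bound is the support value of `K` at `J h`, which is already the limit.
  refine tendsto_of_tendsto_of_tendsto_of_le_of_le (haff ▸ (ht z).sub (ht (z - h)))
    tendsto_const_nhds (fun n => hs.le_fderiv_mollify hK.isBounded (ρ n) z h)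
    fun n => hs.fderiv_mollify_le hK.isBounded (ρ n) z hmax.2

/-! ### Perimeter of graphs and passage to complements -/

/-- Functions on the plane that are Lipschitz on bounded sets. -/
def LipschitzOnBounded (u : ℂ → ℝ) : Prop :=
  ∀ R : ℝ, ∃ C : ℝ≥0, LipschitzOnWith C u (Metric.closedBall 0 R)

namespace LipschitzOnBounded

variable {u : ℂ → ℝ}

lemma continuous (hu : LipschitzOnBounded u) : Continuous u := by
  refine continuous_iff_continuousAt.2 fun z => ?_
  obtain ⟨C, hC⟩ := hu (‖z‖ + 1)
  exact hC.continuousOn.continuousAt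
    (mem_of_superset (Metric.isOpen_ball.mem_nhds (by simp)) Metric.ball_subset_closedBall)

lemma ae_differentiableAt (hu : LipschitzOnBounded u) :
    ∀ᵐ z : ℂ, DifferentiableAt ℝ u z := by
  choose C hC using hu
  have h : ∀ᵐ z : ℂ, ∀ n : ℕ, z ∈ Metric.closedBall (0 : ℂ) n →
      DifferentiableWithinAt ℝ u (Metric.closedBall 0 n) z :=
    ae_all_iff.2 fun n => (hC n).ae_differentiableWithinAt_of_mem
  filter_upwards [h] with z hz
  obtain ⟨n, hn⟩ := exists_nat_gt ‖z‖
  have hm : z ∈ Metric.ball (0 : ℂ) n := by simpa using hn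
  exact (hz n (Metric.ball_subset_closedBall hm)).differentiableAt
    (mem_of_superset (Metric.isOpen_ball.mem_nhds hm) Metric.ball_subset_closedBall)

lemma exists_norm_hnormal_le (hu : LipschitzOnBounded u) (R : ℝ) :
    ∃ M : ℝ, ∀ z ∈ Metric.closedBall (0 : ℂ) R, ‖hnormal u z‖ ≤ M := by
  obtain ⟨C, hC⟩ := hu (R + 1)
  refine ⟨2 * (C + |R|), fun z hz => ?_⟩
  rw [mem_closedBall_zero_iff] at hz
  have hm : z ∈ Metric.ball (0 : ℂ) (R + 1) := by rw [mem_ball_zero_iff]; linarith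
  refine (norm_hnormal_le (norm_fderiv_le_of_lipschitzOn ℝ (mem_of_superset
    (Metric.isOpen_ball.mem_nhds hm) Metric.ball_subset_closedBall) hC)).trans ?_
  have := hz.trans (le_abs_self R)
  gcongr

end LipschitzOnBounded

lemma measurableSet_supergraph {u : ℂ → ℝ} (hu : Continuous u) : MeasurableSet (supergraph u) :=
  (isOpen_lt (hu.comp continuous_fst) continuous_snd).measurableSet

lemma measurableSet_subgraph {u : ℂ → ℝ} (hu : Continuous u) : MeasurableSet (subgraph u) :=
  (isOpen_lt continuous_snd (hu.comp continuous_fst)).measurableSet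

lemma volume_tGraph {u : ℂ → ℝ} (hu : Continuous u) : volume (tGraph u) = 0 := by
  have hm := (measurePreserving_shear u hu).measure_preimage_emb
    (shear u hu).measurableEmbedding (tGraph u)
  have : shear u hu ⁻¹' tGraph u = univ ×ˢ {0} := by
    ext p; simp [shear, tGraph]
  rw [← hm, this, Measure.volume_eq_prod, Measure.prod_prod]
  simp

lemma admissible.mem {K : Set ℂ} (hK : Convex ℝ K) (hc : IsClosed K) (h0 : (0 : ℂ) ∈ interior K)
    {Ω : Set Heis} {w : Heis → ℂ} (hw : w ∈ admissible K Ω) (p : Heis) : w p ∈ K := by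
  have := (gauge_le_one_iff_mem_closure hK (mem_interior_iff_mem_nhds.1 h0)).1 (hw.2.2.2 p)
  rwa [hc.closure_eq] at this

/-- A uniform bound for the integrals of horizontal fields over a piece of a graph. -/
lemma norm_inner_hnormal_le {u : ℂ → ℝ} {R B M : ℝ} (hB0 : 0 ≤ B)
    (hM : ∀ z ∈ Metric.closedBall (0 : ℂ) R, ‖hnormal u z‖ ≤ M) {A : ℂ → ℂ}
    (hA : ∀ z, ‖A z‖ ≤ B) (hA0 : ∀ z, z ∉ Metric.closedBall (0 : ℂ) R → A z = 0) (z : ℂ) :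
    ‖(inner ℝ (A z) (hnormal u z) : ℝ)‖ ≤
      (Metric.closedBall (0 : ℂ) R).indicator (fun _ => B * M) z := by
  by_cases hz : z ∈ Metric.closedBall (0 : ℂ) R
  · rw [indicator_of_mem hz]
    exact (norm_inner_le_norm _ _).trans
      (mul_le_mul (hA z) (hM z hz) (norm_nonneg _) hB0)
  · rw [indicator_of_notMem hz, hA0 z hz, inner_zero_left, norm_zero]

lemma integrable_indicator_closedBall (R c : ℝ) :
    Integrable ((Metric.closedBall (0 : ℂ) R).indicator fun _ => c) :=
  (integrable_indicator_iff measurableSet_closedBall).2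
    (integrableOn_const measure_closedBall_lt_top.ne)

lemma slice_eq_zero {u : ℂ → ℝ} {w : Heis → ℂ} {Ω : Set Heis} (hw : tsupport w ⊆ Ω) {R : ℝ}
    (hR : Prod.fst '' Ω ⊆ Metric.closedBall (0 : ℂ) R) (z : ℂ)
    (hz : z ∉ Metric.closedBall (0 : ℂ) R) : w (z, u z) = 0 :=
  image_eq_zero_of_notMem_tsupport fun h => hz (hR ⟨_, hw h, rfl⟩)

lemma exists_abs_setIntegral_hdiv_le {K : Set ℂ} (hK : Convex ℝ K) (hc : IsCompact K)
    (h0 : (0 : ℂ) ∈ interior K) {u : ℂ → ℝ} (hu : LipschitzOnBounded u) {Ω : Set Heis}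
    (hΩ : Bornology.IsBounded Ω) :
    ∃ B : ℝ, ∀ w ∈ admissible K Ω, |∫ p in supergraph u, hdiv w p| ≤ B := by
  obtain ⟨b, hb⟩ := hc.isBounded.exists_norm_le
  obtain ⟨R, hR⟩ := hΩ.image_fst.subset_closedBall 0
  obtain ⟨M, hM⟩ := hu.exists_norm_hnormal_le R
  refine ⟨∫ z, (Metric.closedBall (0 : ℂ) R).indicator (fun _ => b * M) z, fun w hw => ?_⟩
  rw [setIntegral_hdiv_supergraph hu hw.1 hw.2.1, ← Real.norm_eq_abs]
  refine norm_integral_le_of_norm_le (integrable_indicator_closedBall R (b * M))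
    (Eventually.of_forall fun z => norm_inner_hnormal_le
      ((norm_nonneg _).trans (hb 0 (interior_subset h0))) hM (A := fun z => w (z, u z))
      (fun z => hb _ (admissible.mem hK hc.isClosed h0 hw _))
      (slice_eq_zero hw.2.2.1 hR) z)

lemma subgraph_ae_eq {u : ℂ → ℝ} (hu : Continuous u) :
    subgraph u =ᵐ[volume] ((supergraph u)ᶜ : Set Heis) := by
  have h : ∀ᵐ p : Heis, p ∉ tGraph u := measure_eq_zero_iff_ae_notMem.1 (volume_tGraph hu)
  refine eventuallyEq_set.2 (h.mono fun p hp => ?_)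
  simp only [tGraph, mem_ofPred_eq] at hp
  simp only [subgraph, supergraph, mem_compl_iff, mem_ofPred_eq, not_lt]
  exact ⟨le_of_lt, fun hle => lt_of_le_of_ne hle hp⟩

lemma setIntegral_compl_hdiv {w : Heis → ℂ} (hw : ContDiff ℝ 1 w) (hc : HasCompactSupport w)
    {E : Set Heis} (hE : NullMeasurableSet E) :
    ∫ p in Eᶜ, hdiv w p = -∫ p in E, hdiv w p := by
  have := integral_add_compl₀ hE (integrable_hdiv hw hc)
  rw [integral_hdiv hw hc] at this
  linarith

lemma hasLocallyFinitePerimeter_of_lipschitzOnBounded {K : Set ℂ} (hK : Convex ℝ K)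
    (hc : IsCompact K) (h0 : (0 : ℂ) ∈ interior K) {u : ℂ → ℝ} (hu : LipschitzOnBounded u) :
    HasLocallyFinitePerimeter K (subgraph u) ∧ HasLocallyFinitePerimeter K (supergraph u) := by
  have hm := measurableSet_supergraph hu.continuous
  refine ⟨⟨(measurableSet_subgraph hu.continuous).nullMeasurableSet, fun Ω _ hΩ => ?_⟩,
    ⟨hm.nullMeasurableSet, fun Ω _ hΩ => ?_⟩⟩
  all_goals
    obtain ⟨B, hB⟩ := exists_abs_setIntegral_hdiv_le hK hc h0 hu hΩ
    refine lt_of_le_of_lt (iSup₂_le fun w hw => ?_) (EReal.coe_lt_top B)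
    rw [EReal.coe_le_coe_iff]
  · rw [setIntegral_congr_set (subgraph_ae_eq hu.continuous),
      setIntegral_compl_hdiv hw.1 hw.2.1 hm.nullMeasurableSet]
    exact (neg_le_abs _).trans (hB w hw)
  · exact (le_abs_self _).trans (hB w hw)

lemma perimeter_congr_ae (K : Set ℂ) {E F : Set Heis} (h : E =ᵐ[volume] F) (Ω : Set Heis) :
    perimeter K E Ω = perimeter K F Ω := by
  unfold perimeter
  exact iSup_congr fun w => iSup_congr fun _ => by rw [setIntegral_congr_set h]

lemma hdiv_neg (w : Heis → ℂ) (p : Heis) : hdiv (-w) p = -hdiv w p := by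
  simp only [hdiv, fderiv_neg, neg_apply, Complex.neg_re, Complex.neg_im]
  ring

lemma neg_mem_admissible {K : Set ℂ} {Ω : Set Heis} {w : Heis → ℂ} (hw : w ∈ admissible K Ω) :
    -w ∈ admissible (-K) Ω := by
  refine ⟨hw.1.neg, hw.2.1.neg, ?_, fun p => ?_⟩
  · have : tsupport (-w) = tsupport w := by
      unfold tsupport; rw [Function.support_neg]
    exact this ▸ hw.2.2.1
  · rw [Pi.neg_apply, gauge_neg_set_neg]
    exact hw.2.2.2 p

lemma perimeter_le_perimeter_neg_compl (K : Set ℂ) {E : Set Heis} (hE : NullMeasurableSet E)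
    (Ω : Set Heis) : perimeter K E Ω ≤ perimeter (-K) Eᶜ Ω := by
  refine iSup₂_le fun w hw => ?_
  refine le_trans (le_of_eq ?_) (le_iSup₂ (f := fun w _ => ((∫ p in Eᶜ, hdiv w p : ℝ) : EReal))
    (-w) (neg_mem_admissible hw))
  simp only [hdiv_neg]
  rw [integral_neg, setIntegral_compl_hdiv hw.1 hw.2.1 hE, neg_neg]

/-- Reversing the norm corresponds to passing to the complement. -/
lemma perimeter_neg_compl (K : Set ℂ) {E : Set Heis} (hE : NullMeasurableSet E) (Ω : Set Heis) :
    perimeter (-K) Eᶜ Ω = perimeter K E Ω := by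
  refine le_antisymm ?_ (perimeter_le_perimeter_neg_compl K hE Ω)
  simpa using perimeter_le_perimeter_neg_compl (-K) hE.compl Ω

lemma IsPerimeterMinimizing.subgraph_neg {K : Set ℂ} {u : ℂ → ℝ} (hu : Continuous u)
    (h : IsPerimeterMinimizing K (supergraph u)) : IsPerimeterMinimizing (-K) (subgraph u) := by
  refine ⟨(measurableSet_subgraph hu).nullMeasurableSet, fun Ω hΩ hb F hF ⟨C, hC, hCΩ, hFC⟩ => ?_⟩
  have h0 := volume_tGraph hu
  have hdiff : (Fᶜ \ tGraph u : Set Heis) =ᵐ[volume] (Fᶜ : Set Heis) := sdiff_null_ae_eq_self h0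
  -- The complement of the subgraph contains the graph. Removing this null set makes the competitor
  -- agree with the open supergraph off `C`.
  have key := h.2 Ω hΩ hb (Fᶜ \ tGraph u)
    (hF.compl.diff (NullMeasurableSet.of_null h0)) ⟨C, hC, hCΩ, ?_⟩
  · rw [perimeter_congr_ae K hdiff] at key
    rw [perimeter_congr_ae (-K) (subgraph_ae_eq hu),
      perimeter_neg_compl K (measurableSet_supergraph hu).nullMeasurableSet]
    have := perimeter_neg_compl (-K) hF Ω
    rw [neg_neg] at this
    exact key.trans_eq this
  · ext p
    have hp := Set.ext_iff.1 hFC p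
    simp only [Set.mem_sdiff, subgraph, supergraph, tGraph, mem_compl_iff, mem_ofPred_eq] at hp ⊢
    by_cases hpC : p ∈ C
    · simp [hpC]
    · simp only [hpC, not_false_eq_true, and_true] at hp ⊢
      rw [hp, not_lt]
      exact ⟨fun h => lt_of_le_of_ne h.1 (Ne.symm h.2), fun h => ⟨h.le, h.ne'⟩⟩

/-! ### Minimality of calibrated graphs -/

lemma exists_cutoff {A Ω : Set Heis} (hA : IsCompact A) (hΩ : IsOpen Ω) (h : A ⊆ Ω) :
    ∃ φ : Heis → ℝ, ContDiff ℝ 1 φ ∧ HasCompactSupport φ ∧ tsupport φ ⊆ Ω ∧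
      (∀ p ∈ A, φ =ᶠ[𝓝 p] fun _ => 1) ∧ ∀ p, φ p ∈ Icc (0 : ℝ) 1 := by
  obtain ⟨t, ht, hAt, htΩ⟩ := exists_compact_between hA hΩ h
  obtain ⟨f, h1, h2, h3⟩ := exists_contMDiffMap_one_nhds_of_subset_interior (n := 1)
    (𝓘(ℝ, Heis)) hA.isClosed hAt
  have hsupp : Function.support f ⊆ t := fun p hp => by
    by_contra hpt
    exact hp (h2 p hpt)
  refine ⟨f, f.contMDiff.contDiff, HasCompactSupport.of_support_subset_isCompact ht hsupp,
    (closure_minimal hsupp ht.isClosed).trans htΩ, fun p hp => ?_, h3⟩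
  exact eventually_nhdsSet_iff_forall.1 h1 p hp

/-- The product of a cutoff function and a horizontal field that does not depend on `t`. -/
def cutoffField (φ : Heis → ℝ) (W : ℂ → ℂ) (p : Heis) : ℂ := φ p • W p.1

lemma cutoffField_mem_admissible {K : Set ℂ} {Ω : Set Heis} {φ : Heis → ℝ}
    {W : ℂ → ℂ} (hφ : ContDiff ℝ 1 φ) (hφc : HasCompactSupport φ) (hφΩ : tsupport φ ⊆ Ω)
    (hφ01 : ∀ p, φ p ∈ Icc (0 : ℝ) 1) (hW : ContDiff ℝ 1 W) (hWK : ∀ z, W z ∈ K) :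
    cutoffField φ W ∈ admissible K Ω := by
  refine ⟨hφ.smul (hW.comp contDiff_fst), hφc.smul_right,
    (closure_mono (Function.support_smul_subset_left _ _)).trans hφΩ, fun p => ?_⟩
  rw [cutoffField, gauge_smul_of_nonneg (hφ01 p).1, smul_eq_mul]
  exact mul_le_one₀ (hφ01 p).2 (gauge_nonneg _) (gauge_le_one_of_mem (hWK _))

lemma hdiv_cutoffField_eq_zero {φ : Heis → ℝ} {W : ℂ → ℂ}
    (hW : ∀ p, hdiv (fun p : Heis => W p.1) p = 0) {p : Heis} (hp : φ =ᶠ[𝓝 p] fun _ => 1) :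
    hdiv (cutoffField φ W) p = 0 := by
  have : cutoffField φ W =ᶠ[𝓝 p] fun p => W p.1 := hp.mono fun q hq => by
    simp [cutoffField, hq]
  rw [← hW p, hdiv, hdiv, this.fderiv_eq]

lemma setIntegral_eq_of_diff_eq {g : Heis → ℝ} (hg : Integrable g) {E F C : Set Heis}
    (hC : MeasurableSet C) (h0 : ∀ p ∈ C, g p = 0) (h : F \ C = E \ C) :
    ∫ p in F, g p = ∫ p in E, g p := by
  have hz : ∀ A : Set Heis, ∫ p in A, g p = ∫ p in A \ C, g p := fun A => by
    rw [← integral_inter_add_sdiff hC hg.integrableOn,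
      setIntegral_eq_zero_of_forall_eq_zero (t := A ∩ C) fun p hp => h0 p hp.2, zero_add]
  rw [hz F, hz E, h]

lemma tendsto_bumpRadius : Tendsto (fun n : ℕ => 1 / ((n : ℝ) + 1)) atTop (𝓝 0) :=
  tendsto_one_div_add_atTop_nhds_zero_nat

/-- A sequence of mollifiers that concentrates at the origin. -/
def bumpSeq (n : ℕ) : ContDiffBump (0 : ℂ) :=
  ⟨1 / ((n : ℝ) + 1) / 2, 1 / ((n : ℝ) + 1), by positivity, half_lt_self (by positivity)⟩

/-- A graph is minimizing above if it is calibrated by a rotated field of subgradients. The vector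
`h z` points to `z` from a point such that the potential is affine in between. -/
theorem isPerimeterMinimizing_supergraph {K : Set ℂ} (hK : Convex ℝ K) (hc : IsCompact K)
    (h0 : (0 : ℂ) ∈ interior K) {u : ℂ → ℝ} (hu : LipschitzOnBounded u) {ψ : ℂ → ℝ} {Φ h : ℂ → ℂ}
    (hs : IsRotatedSubgradient K ψ Φ)
    (hmax : ∀ z, IsSupportPoint K (Complex.I * h z) (Φ z))
    (haff : ∀ z, ψ z - ψ (z - h z) = inner ℝ (Φ z) (Complex.I * h z))
    (hν : ∀ᵐ z, ∃ s : ℝ, 0 ≤ s ∧ hnormal u z = s • (Complex.I * h z)) :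
    IsPerimeterMinimizing K (supergraph u) := by
  refine ⟨(measurableSet_supergraph hu.continuous).nullMeasurableSet,
    fun Ω hΩ hb F hF ⟨C, hC, hCΩ, hFC⟩ => iSup₂_le fun w hw => ?_⟩
  obtain ⟨φ, hφ, hφc, hφΩ, hφ1, hφ01⟩ := exists_cutoff (hC.union hw.2.1.isCompact) hΩ
    (union_subset hCΩ hw.2.2.1)
  have hcont := hs.continuous hc.isBounded
  set W : ℕ → ℂ → ℂ := fun n => rotGrad (mollify (bumpSeq n) ψ) with hW
  have hWK : ∀ n z, W n z ∈ K := fun n z => hs.rotGrad_mollify_mem hc hK (bumpSeq n) z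
  have hWC : ∀ n, ContDiff ℝ 1 (W n) := fun n => contDiff_rotGrad (contDiff_mollify _ hcont)
  have hadm : ∀ n, cutoffField φ (W n) ∈ admissible K Ω := fun n =>
    cutoffField_mem_admissible hφ hφc hφΩ hφ01 (hWC n) (hWK n)
  -- On `C` the cutoff is locally 1 and the divergence vanishes; off `C` the sets `F` and the
  -- supergraph coincide.
  have heq : ∀ n, ∫ p in F, hdiv (cutoffField φ (W n)) p =
      ∫ z, inner ℝ (cutoffField φ (W n) (z, u z)) (hnormal u z) := fun n => by
    rw [← setIntegral_hdiv_supergraph hu (hadm n).1 (hadm n).2.1]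
    exact setIntegral_eq_of_diff_eq (integrable_hdiv (hadm n).1 (hadm n).2.1) hC.measurableSet
      (fun p hp => hdiv_cutoffField_eq_zero (fun q => hdiv_rotGrad (contDiff_mollify _ hcont) q)
        (hφ1 p (Or.inl hp))) hFC
  obtain ⟨b, hKb⟩ := hc.isBounded.exists_norm_le
  have hb0 : 0 ≤ b := (norm_nonneg _).trans (hKb 0 (interior_subset h0))
  obtain ⟨R, hR⟩ := hb.image_fst.subset_closedBall 0
  obtain ⟨M, hM⟩ := hu.exists_norm_hnormal_le R
  have hbound : ∀ n z, ‖(inner ℝ (cutoffField φ (W n) (z, u z)) (hnormal u z) : ℝ)‖ ≤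
      (Metric.closedBall (0 : ℂ) R).indicator (fun _ => b * M) z := fun n z =>
    norm_inner_hnormal_le hb0 hM (A := fun z => cutoffField φ (W n) (z, u z))
      (fun z => hKb _ (admissible.mem hK hc.isClosed h0 (hadm n) _))
      (slice_eq_zero (hadm n).2.2.1 hR) z
  have hmeas : ∀ {A : Heis → ℂ}, Continuous A →
      AEStronglyMeasurable (fun z => (inner ℝ (A (z, u z)) (hnormal u z) : ℝ)) volume :=
    fun hA => (hA.comp (continuous_id.prodMk hu.continuous)).aestronglyMeasurable.inner
      (measurable_hnormal u).aestronglyMeasurable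
  set G : ℂ → ℝ := fun z => φ (z, u z) * inner ℝ (Φ z) (hnormal u z) with hG
  -- The normal is a multiple of `J (h z)`, so only the derivative of the mollified potential along
  -- `h z` enters.
  have hlim : ∀ᵐ z, Tendsto (fun n => (inner ℝ (cutoffField φ (W n) (z, u z)) (hnormal u z) : ℝ))
      atTop (𝓝 (G z)) := by
    filter_upwards [hν] with z ⟨s, _, hsz⟩
    have ht := hs.tendsto_fderiv_mollify hc (ρ := bumpSeq) tendsto_bumpRadius (hmax z) (haff z)
    have e : ∀ n, (inner ℝ (cutoffField φ (W n) (z, u z)) (hnormal u z) : ℝ) =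
        φ (z, u z) * (s * fderiv ℝ (mollify (bumpSeq n) ψ) z (h z)) := fun n => by
      rw [cutoffField, real_inner_smul_left, hsz, real_inner_smul_right, hW, inner_rotGrad]
    simp only [e, hG]
    rw [hsz, real_inner_smul_right]
    exact (ht.const_mul s).const_mul _
  have hint := tendsto_integral_of_dominated_convergence _ (fun n => hmeas (hadm n).1.continuous)
    (integrable_indicator_closedBall R (b * M)) (fun n => Eventually.of_forall (hbound n)) hlim
  -- Measurability of `G` is inherited from the approximations, as none is assumed for `Φ`.
  have hGint : Integrable G :=
    ⟨aestronglyMeasurable_of_tendsto_ae _ (fun n => hmeas (hadm n).1.continuous) hlim,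
      hasFiniteIntegral_of_dominated_convergence (integrable_indicator_closedBall R (b * M)).2
        (fun n => Eventually.of_forall (hbound n)) hlim⟩
  have hle : ∫ p in supergraph u, hdiv w p ≤ ∫ z, G z := by
    rw [setIntegral_hdiv_supergraph hu hw.1 hw.2.1]
    refine integral_mono_ae ((integrable_indicator_closedBall R (b * M)).mono'
      (hmeas hw.1.continuous) (Eventually.of_forall fun z => norm_inner_hnormal_le hb0 hM
        (A := fun z => w (z, u z)) (fun z => hKb _ (admissible.mem hK hc.isClosed h0 hw _))
        (slice_eq_zero hw.2.2.1 hR) z)) hGint ?_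
    filter_upwards [hν] with z ⟨s, hs0, hsz⟩
    have hin : ∀ q ∈ K, (inner ℝ q (hnormal u z) : ℝ) ≤ inner ℝ (Φ z) (hnormal u z) := by
      intro q hq
      rw [hsz, real_inner_smul_right, real_inner_smul_right]
      exact mul_le_mul_of_nonneg_left ((hmax z).2 q hq) hs0
    -- On the support of `w` the cutoff is 1 and `Φ` maximizes the pairing over `K`; elsewhere `G ≥
    -- 0` because `0 ∈ K`.
    by_cases hz : (z, u z) ∈ tsupport w
    · have : φ (z, u z) = 1 := (hφ1 _ (Or.inr hz)).self_of_nhds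
      simp only [hG, this, one_mul]
      exact hin _ (admissible.mem hK hc.isClosed h0 hw _)
    · rw [image_eq_zero_of_notMem_tsupport hz, inner_zero_left]
      have := hin 0 (interior_subset h0)
      rw [inner_zero_left] at this
      exact mul_nonneg (hφ01 _).1 this
  refine (EReal.coe_le_coe_iff.2 hle).trans (le_of_tendsto
    ((continuous_coe_real_ereal.tendsto _).comp hint) (Eventually.of_forall fun n => ?_))
  simp only [Function.comp_apply, ← heq]
  exact le_iSup₂ (f := fun w _ => ((∫ p in F, hdiv w p : ℝ) : EReal)) _ (hadm n)

/-! ### The horizontal normal of the ruled graph -/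

/-- The point `lam` such that the half-line through `z` starts at `lam v`. -/
def footAt (v : ℂ) (cp cm : ℝ → ℝ) (z : ℂ) : ℝ := foot cp cm (z / v).re (z / v).im

section Ruling

variable {v : ℂ} {cp cm : ℝ → ℝ}

lemma IsRuling.footAt_real_mul (h : IsRuling cp cm) (hv : v ≠ 0) (lam : ℝ) :
    footAt v cp cm (lam * v) = lam := by
  rw [footAt, mul_div_cancel_right₀ _ hv, Complex.ofReal_re, Complex.ofReal_im, h.foot_zero]

lemma div_add_real_mul (hv : v ≠ 0) (z : ℂ) (s : ℝ) : (z + s * v) / v = z / v + s := by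
  field_simp

lemma inner_mul_I_left (hv : v ≠ 0) (z : ℂ) :
    (inner ℝ (Complex.I * z) v : ℝ) = -(Complex.normSq v * (z / v).im) := by
  have h1 : Complex.I * z = Complex.I * (z / v) * v := by field_simp
  have h2 := inner_mul_mul (Complex.I * (z / v)) 1 v
  rw [one_mul] at h2
  rw [h1, h2, complex_inner]
  simp

lemma inner_hnormal (u : ℂ → ℝ) (z d : ℂ) :
    (inner ℝ (hnormal u z) d : ℝ) = fderiv ℝ u z d + inner ℝ (Complex.I * z) d := by
  have : d = d.re • (1 : ℂ) + d.im • Complex.I := by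
    simp [Complex.re_add_im]
  have h2 : fderiv ℝ u z d = d.re * fderiv ℝ u z 1 + d.im * fderiv ℝ u z Complex.I := by
    conv_lhs => rw [this, map_add, map_smul, map_smul]
    simp
  rw [h2, complex_inner, complex_inner]
  simp [hnormal]
  ring

/-- The dilation about the foot with ratio `1 + s ≥ 0` preserves the half-line. -/
lemma IsRuling.footAt_add_smul (h : IsRuling cp cm) (hv : v ≠ 0) (z : ℂ) {s : ℝ} (hs : -1 ≤ s) :
    footAt v cp cm (z + s • (z - footAt v cp cm z * v)) = footAt v cp cm z ∧
    ((z + s • (z - footAt v cp cm z * v)) / v).im = (1 + s) * (z / v).im := by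
  set lam := footAt v cp cm z with hlam
  have e : (z + s • (z - lam * v)) / v = (1 + s : ℝ) * (z / v) - (s * lam : ℝ) := by
    rw [Complex.real_smul]; push_cast; field_simp; ring
  have hre : ((z + s • (z - lam * v)) / v).re = (1 + s) * (z / v).re - s * lam := by
    rw [e, Complex.sub_re, Complex.re_ofReal_mul, Complex.ofReal_re]
  have him : ((z + s • (z - lam * v)) / v).im = (1 + s) * (z / v).im := by
    rw [e, Complex.sub_im, Complex.im_ofReal_mul, Complex.ofReal_im, sub_zero]
  refine ⟨h.foot_eq ?_, him⟩
  have hf := h.rayAbscissa_foot (z / v).re (z / v).im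
  change rayAbscissa cp cm (z / v).im lam = _ at hf
  have h1 : 0 ≤ 1 + s := by linarith
  have m1 : max ((1 + s) * (z / v).im) 0 = (1 + s) * max (z / v).im 0 := by
    rw [mul_max_of_nonneg _ _ h1, mul_zero]
  have m2 : max (-((1 + s) * (z / v).im)) 0 = (1 + s) * max (-(z / v).im) 0 := by
    rw [mul_max_of_nonneg _ _ h1, mul_zero, mul_neg]
  rw [hre, him, rayAbscissa, m1, m2]
  unfold rayAbscissa at hf
  linear_combination (1 + s) * hf

/-- Euler's identity: the height is homogeneous of degree one along each half-line about its foot.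
-/
lemma IsRuling.fderiv_ruledHeight_ray (h : IsRuling cp cm) (hv : v ≠ 0) {z : ℂ}
    (hd : DifferentiableAt ℝ (ruledHeight v cp cm) z) :
    fderiv ℝ (ruledHeight v cp cm) z (z - footAt v cp cm z * v) = ruledHeight v cp cm z := by
  have h1 : HasDerivAt (fun s : ℝ => ruledHeight v cp cm (z + s • (z - footAt v cp cm z * v)))
      (fderiv ℝ (ruledHeight v cp cm) z (z - footAt v cp cm z * v)) 0 :=
    hd.hasFDerivAt.hasLineDerivAt _
  have h2 : HasDerivAt (fun s : ℝ => (1 + s) * ruledHeight v cp cm z)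
      (1 * ruledHeight v cp cm z) 0 :=
    ((hasDerivAt_id (0 : ℝ)).const_add 1).mul_const _
  rw [one_mul] at h2
  refine h1.unique (h2.congr_of_eventuallyEq ?_)
  filter_upwards [Ioi_mem_nhds (show (-1 : ℝ) < 0 by norm_num)] with s hs
  obtain ⟨h3, h4⟩ := h.footAt_add_smul hv z (le_of_lt hs)
  unfold ruledHeight
  change -(Complex.normSq v * (_ * footAt v cp cm _)) =
    (1 + s) * -(Complex.normSq v * (_ * footAt v cp cm z))
  rw [h3, h4]
  ring

/-- At fixed ordinate the foot is non-decreasing in the abscissa, and the height is `-|v|²` times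
ordinate times foot. This is where the ordering of the half-lines fixes the sign of the normal. -/
lemma IsRuling.mul_fderiv_ruledHeight_nonpos (h : IsRuling cp cm) (hv : v ≠ 0) {z : ℂ}
    (hd : DifferentiableAt ℝ (ruledHeight v cp cm) z) :
    (z / v).im * fderiv ℝ (ruledHeight v cp cm) z v ≤ 0 := by
  have := fderiv_le_of_forall (f := fun x => (z / v).im * ruledHeight v cp cm x) (h := v) (B := 0)
    (hd.const_mul _) fun s hs => ?_
  · rwa [fderiv_const_mul hd, smul_apply, smul_eq_mul] at this
  · have e := div_add_real_mul hv z s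
    have hm := h.monotone_foot (z / v).im (show (z / v).re ≤ (z / v).re + s by linarith)
    have hsq : 0 ≤ Complex.normSq v * (z / v).im ^ 2 :=
      mul_nonneg (Complex.normSq_nonneg v) (sq_nonneg _)
    unfold ruledHeight
    rw [Complex.real_smul, e, Complex.add_re, Complex.add_im, Complex.ofReal_re, Complex.ofReal_im,
      add_zero]
    simp only at hm
    nlinarith [mul_le_mul_of_nonneg_left hm hsq]

/-- The horizontal normal of a ruled graph is a positive multiple of the direction of the ruling
turned by a right angle. -/
lemma IsRuling.hnormal_ruledHeight (h : IsRuling cp cm) (hv : v ≠ 0) {z : ℂ}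
    (hd : DifferentiableAt ℝ (ruledHeight v cp cm) z) (hz : (z / v).im ≠ 0) :
    ∃ s : ℝ, 0 ≤ s ∧ hnormal (ruledHeight v cp cm) z =
      s • (Complex.I * (z - footAt v cp cm z * v)) := by
  set d := z - footAt v cp cm z * v with hd'
  set n := hnormal (ruledHeight v cp cm) z with hn
  have hN : 0 < Complex.normSq v := Complex.normSq_pos.2 hv
  have h1 : (inner ℝ n d : ℝ) = 0 := by
    rw [hn, inner_hnormal, h.fderiv_ruledHeight_ray hv hd, hd', inner_sub_right,
      ← Complex.real_smul, real_inner_smul_right, inner_mul_I_left hv]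
    have : (inner ℝ (Complex.I * z) z : ℝ) = 0 := by rw [complex_inner]; simp; ring
    rw [this, ruledHeight, footAt]
    ring
  have h2 : (inner ℝ n v : ℝ) = fderiv ℝ (ruledHeight v cp cm) z v -
      Complex.normSq v * (z / v).im := by
    rw [hn, inner_hnormal, inner_mul_I_left hv]; ring
  have h3 : (inner ℝ (Complex.I * d) v : ℝ) = -(Complex.normSq v * (z / v).im) := by
    have : (d / v).im = (z / v).im := by
      rw [hd', sub_div, mul_div_cancel_right₀ _ hv, Complex.sub_im, Complex.ofReal_im, sub_zero]
    rw [inner_mul_I_left hv, this]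
  have hd0 : d ≠ 0 := by
    intro h0
    rw [h0, mul_zero, inner_zero_left] at h3
    exact (mul_ne_zero hN.ne' hz) (by linarith)
  have hsq : 0 < d.re ^ 2 + d.im ^ 2 := by
    have := Complex.normSq_pos.2 hd0
    rw [Complex.normSq_apply] at this
    linarith
  set s := (n.im * d.re - n.re * d.im) / (d.re ^ 2 + d.im ^ 2) with hs
  rw [complex_inner] at h1
  have hsd : s * (d.re ^ 2 + d.im ^ 2) = n.im * d.re - n.re * d.im :=
    div_mul_cancel₀ _ hsq.ne'
  have hns : n = s • (Complex.I * d) := by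
    apply Complex.ext
    · rw [Complex.smul_re, Complex.I_mul_re, smul_eq_mul]
      apply mul_left_cancel₀ hsq.ne'
      linear_combination d.re * h1 + d.im * hsd
    · rw [Complex.smul_im, Complex.I_mul_im, smul_eq_mul]
      apply mul_left_cancel₀ hsq.ne'
      linear_combination d.im * h1 - d.re * hsd
  refine ⟨s, ?_, hns⟩
  -- Pairing `n = s J d` with `v` turns this sign condition into `(1 - s) |v|² y² ≤ 0`, where `y` is
  -- the ordinate of `z / v`; so in fact `s ≥ 1`.
  have h4 := h.mul_fderiv_ruledHeight_nonpos hv hd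
  have h5 : s * -(Complex.normSq v * (z / v).im) = fderiv ℝ (ruledHeight v cp cm) z v -
      Complex.normSq v * (z / v).im := by
    rw [← h2, ← h3, hns, real_inner_smul_left]
  have h6 : 0 < Complex.normSq v * (z / v).im ^ 2 := by positivity
  by_contra hneg
  push Not at hneg
  have h7 : (z / v).im * fderiv ℝ (ruledHeight v cp cm) z v =
      (1 - s) * (Complex.normSq v * (z / v).im ^ 2) := by
    linear_combination -(z / v).im * h5
  nlinarith

lemma ae_im_div_ne_zero (hv : v ≠ 0) : ∀ᵐ z : ℂ, (z / v).im ≠ 0 := by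
  set L : ℂ →ₗ[ℝ] ℝ := Complex.imCLM.toLinearMap ∘ₗ (LinearMap.mulRight ℝ (v⁻¹)) with hL
  have hLz : ∀ z, L z = (z / v).im := fun z => by simp [hL, div_eq_mul_inv]
  have hne : LinearMap.ker L ≠ ⊤ := by
    intro ht
    have : L (Complex.I * v) = 0 := LinearMap.mem_ker.1 (ht ▸ Submodule.mem_top)
    rw [hLz, mul_div_cancel_right₀ _ hv] at this
    simp at this
  have h0 := Measure.addHaar_submodule (volume : Measure ℂ) _ hne
  filter_upwards [measure_eq_zero_iff_ae_notMem.1 h0] with z hz hz0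
  exact hz (LinearMap.mem_ker.2 (by rw [hLz, hz0]))

end Ruling

/-! ### The calibrating field -/

/-- The value of the calibration: the boundary point of `K` whose normal is the direction of the
half-line through `z` turned by a right angle. -/
def calibration (K : Set ℂ) (v : ℂ) (cp cm : ℝ → ℝ) (z : ℂ) : ℂ :=
  if 0 ≤ (z / v).im then piK K (Complex.I * (v * (cp (footAt v cp cm z) + Complex.I)))
  else piK K (Complex.I * (v * (cm (footAt v cp cm z) + -Complex.I)))

lemma IsSupportPoint.real_mul {K : Set ℂ} {n p : ℂ} (h : IsSupportPoint K n p) {r : ℝ}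
    (hr : 0 ≤ r) : IsSupportPoint K (r * n) p :=
  ⟨h.1, fun q hq => by
    rw [← Complex.real_smul, real_inner_smul_right, real_inner_smul_right]
    exact mul_le_mul_of_nonneg_left (h.2 q hq) hr⟩

/-- The vector from the foot to `z` is `|y|` times `v (cp + I)` or `v (cm - I)`, and nonnegative
factors preserve support points. On the line `ℝ v` the normal is zero, so the value chosen there is
immaterial. -/
lemma IsRuling.isSupportPoint_calibration {K : Set ℂ} (hK : IsCompact K) (hne : K.Nonempty)
    {v : ℂ} (hv : v ≠ 0) {cp cm : ℝ → ℝ} (h : IsRuling cp cm) (z : ℂ) :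
    IsSupportPoint K (Complex.I * (z - footAt v cp cm z * v)) (calibration K v cp cm z) := by
  set lam := footAt v cp cm z with hlam
  have hf := h.rayAbscissa_foot (z / v).re (z / v).im
  change rayAbscissa cp cm (z / v).im lam = _ at hf
  unfold rayAbscissa at hf
  have hz : z = ((z / v).re + (z / v).im * Complex.I) * v := by
    rw [Complex.re_add_im, div_mul_cancel₀ _ hv]
  have hre : ((z / v).re : ℂ) = lam + ((max (z / v).im 0 * cp lam + max (-(z / v).im) 0 * cm lam : ℝ) : ℂ) := by
    exact_mod_cast hf.symm
  unfold calibration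
  split_ifs with hy
  · have := (isSupportPoint_piK hK hne (normal_ne_zero (e := Complex.I) hv (by simp)
      (cp lam))).real_mul hy
    convert this using 1
    rw [max_eq_left hy, max_eq_right (by linarith)] at hre
    push_cast at hre
    linear_combination Complex.I * hz + Complex.I * v * hre
  · push Not at hy
    have := (isSupportPoint_piK hK hne (normal_ne_zero (e := -Complex.I) hv (by simp)
      (cm lam))).real_mul (r := -(z / v).im) (by linarith)
    convert this using 1
    rw [max_eq_right hy.le, max_eq_left (by linarith)] at hre
    push_cast at hre ⊢
    linear_combination Complex.I * hz + Complex.I * v * hre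

end SubFinsler

end

open SubFinsler

/-! ### Proof of the proposition -/

theorem proposition4p2 (K : Set ℂ) (hK : SubFinsler.IsC2Plus K) (h0 : (0 : ℂ) ∈ interior K)
    (v : ℂ) (hv : v ≠ 0) (α : ℝ → ℝ) (hα : ∀ lam, α lam ∈ Set.Ioo 0 Real.pi)
    (hcont : Continuous α) (hmono : Antitone α) :
    ∃ u : ℂ → ℝ, SubFinsler.surface K v α = SubFinsler.tGraph u ∧
      LocallyLipschitz u ∧
      SubFinsler.HasLocallyFinitePerimeter K (SubFinsler.subgraph u) ∧
      SubFinsler.HasLocallyFinitePerimeter K (SubFinsler.supergraph u) ∧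
      SubFinsler.IsPerimeterMinimizing K (SubFinsler.supergraph u) ∧
      SubFinsler.IsPerimeterMinimizing (-K) (SubFinsler.subgraph u) := by
  have hne : K.Nonempty := ⟨0, interior_subset h0⟩
  set β : ℝ → ℝ := fun lam => conjAngle K v (α lam) with hβ
  have hconj : ∀ lam, IsConjAngle K v (α lam) (β lam) := fun lam =>
    hK.isConjAngle_conjAngle h0 hv (hα lam)
  have hsα : ∀ lam, 0 < Real.sin (α lam) := fun lam => Real.sin_pos_of_mem_Ioo (hα lam)
  have hsβ : ∀ lam, Real.sin (β lam) < 0 := fun lam => by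
    have h1 := (hconj lam).1
    have := Real.sin_pos_of_pos_of_lt_pi (x := β lam - Real.pi) (by linarith [h1.1])
      (by linarith [h1.2])
    rw [Real.sin_sub_pi] at this
    linarith
  set cp : ℝ → ℝ := fun lam => Real.cos (α lam) / Real.sin (α lam) with hcp
  set cm : ℝ → ℝ := fun lam => -(Real.cos (β lam) / Real.sin (β lam)) with hcm
  set H : ℝ → ℝ := fun lam => height K v Complex.I (cp lam) with hH
  have hIim : Complex.I.im ≠ 0 := by simp
  have hIim' : (-Complex.I).im ≠ 0 := by simp
  have hg := hK.strictMono_height h0 hv hIim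
  have hg' := hK.strictMono_height h0 hv hIim'
  have hgc := hK.continuous_height hne hv hIim
  have hgc' := hK.continuous_height hne hv hIim'
  have hcpm : Monotone cp := by
    intro a b hab
    have h1 := hmono hab
    -- The subtraction formula for the sine expresses that the cotangent decreases on `(0, π)`.
    have h2 : 0 ≤ Real.sin (α a - α b) := Real.sin_nonneg_of_nonneg_of_le_pi (by linarith)
      (by linarith [(hα a).2, (hα b).1])
    rw [Real.sin_sub] at h2
    simp only [hcp]
    rw [div_le_div_iff₀ (hsα a) (hsα b)]
    linarith
  have hcpc : Continuous cp :=
    (Real.continuous_cos.comp hcont).div (Real.continuous_sin.comp hcont) fun lam => (hsα lam).ne'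
  have hHm : Monotone H := hg.monotone.comp hcpm
  have hHc : Continuous H := hgc.comp hcpc
  -- The defining relation of `β`: a multiple of `v` has no `J v`-component, so both half-lines from
  -- `lam` give the height `H lam`.
  have hcmH : ∀ lam, height K v (-Complex.I) (cm lam) = H lam := by
    intro lam
    obtain ⟨-, c, hc⟩ := hconj lam
    have e1 : piK K (Complex.I * turn v (α lam)) =
        piK K (Complex.I * (v * (cp lam + Complex.I))) := by
      rw [turn_eq_of_sin_ne_zero v (hsα lam).ne' 1 (by norm_num), mul_left_comm,
        piK_real_mul K (by simpa using hsα lam)]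
      simp [hcp]
    have e2 : piK K (Complex.I * turn v (β lam)) =
        piK K (Complex.I * (v * (cm lam + -Complex.I))) := by
      rw [turn_eq_of_sin_ne_zero v (hsβ lam).ne (-1) (by norm_num), mul_left_comm,
        piK_real_mul K (by simpa using hsβ lam)]
      simp [hcm]
    rw [e1, e2] at hc
    have h1 : (inner ℝ ((c : ℂ) * v) (Complex.I * v) : ℝ) = 0 := by
      rw [inner_mul_mul, complex_inner]; simp
    rw [← hc, inner_sub_left] at h1
    simp only [hH, height]
    linarith
  have hcmm : Monotone cm := monotone_of_strictMono_comp hg' hHm hcmH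
  have hrul : IsRuling cp cm :=
    ⟨hcpm, hcmm, fun y hy x => exists_add_mul_eq hg hgc hHm hHc (fun _ => rfl) hy x,
      fun y hy x => exists_add_mul_eq hg' hgc' hHm hHc hcmH hy x⟩
  have hu : LipschitzOnBounded (ruledHeight v cp cm) := hrul.lipschitzOnWith_ruledHeight v
  have hper := hasLocallyFinitePerimeter_of_lipschitzOnBounded hK.convex hK.compact h0 hu
  have hsupp := hrul.isSupportPoint_calibration hK.compact hne hv
  have hΦH : ∀ z, (inner ℝ (calibration K v cp cm z) (Complex.I * v) : ℝ) =
      H (footAt v cp cm z) := by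
    intro z
    unfold calibration
    split_ifs
    · rfl
    · exact hcmH _
  have hmin : IsPerimeterMinimizing K (supergraph (ruledHeight v cp cm)) := by
    refine isPerimeterMinimizing_supergraph hK.convex hK.compact h0 hu
      (isRotatedSubgradient_potential hHm hsupp hΦH) hsupp (fun z => ?_) ?_
    -- The segment starts at the foot `Λ v`, where the second term of the potential vanishes and the
    -- integral term is the same as at `z`.
    · rw [sub_sub_cancel]
      unfold potential
      rw [hrul.footAt_real_mul hv]
      simp
    · filter_upwards [hu.ae_differentiableAt, ae_im_div_ne_zero hv] with z hz hz0
      exact hrul.hnormal_ruledHeight hv hz hz0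
  exact ⟨ruledHeight v cp cm,
    hrul.iUnion_horizontalRay_eq hv hsα hsβ (fun _ => rfl) fun _ => rfl,
    hrul.locallyLipschitz_ruledHeight v, hper.1, hper.2, hmin, hmin.subgraph_neg hu.continuous⟩
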